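/- Identify $\mathbb R^2$ with $\mathbb C$, let $\mathcal S$ be the Schwartz class of complex functions on $\mathbb C$, and let $\langle f,g\rangle=\int f\bar g$. *Haar averages.* For an interval $I=[a,a+\ell)$ let $h_I=\ell^{-1/2}(\chi_{[a+\ell/2,a+\ell)}-\chi_{[a,a+\ell/2)})$, and for a square $Q=I\times J$ with sides of equal length let $h_Q^0=|I|^{-1/2}\chi_I\otimes h_J$. For $\rho>0$ and $t\in\mathbb C$ let $\mathcal G_t^\rho$ be the grid of half-open squares of side $\rho$ having $t$ as a vertex, and put $$\mathcal P_t^\rho f=\sum_{Q\in\mathcal G_t^\rho}\langle f,h_Q^0\rangle h_Q^0,\qquad (U_\psi f)(z)=f(e^{-i\psi}z),$$ $$\mathcal A^\rho f=\frac1{2\pi}\int_0^{2\pi}U_\psi\Big(\frac1{\rho^2}\int_{[0,\rho)^2}\mathcal P_t^\rho (U_\psi^{-1}f)\,dt\Big)e^{-2i\psi}\,d\psi .$$ *Kernels.* Let $\chi_0=\chi_{(-1/2,1/2]}$, $h_0=\chi_{(0,1/2]}-\chi_{(-1/2,0]}$, $\alpha=h_0*h_0$, $\beta=\chi_0*\chi_0$,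 $F(x+iy)=-\beta(x)\alpha(y)$, $F^\rho(z)=\rho^{-2}F(z/\rho)$, and $$G^\rho=\frac1{2\pi}\int_0^{2\pi}(U_\psi F^\rho)e^{-2i\psi}\,d\psi,\qquad k^r=\sum_{n\in\mathbb Z}G^{2^nr}.$$ *Operators.* For $f\in\mathcal S$ and $z\in\mathbb C$ let $$(\mathcal K^rf)(z)=\lim_{\varepsilon\to0}\int_{|y|>\varepsilon}k^r(y)f(z-y)\,dy,\qquad (Sf)(z)=\int_1^2(\mathcal K^rf)(z)\,\frac{dr}r,$$ $$(Tf)(z)=-\frac1\pi\lim_{\varepsilon\to0}\int_{|\zeta-z|>\varepsilon}\frac{f(\zeta)}{(\zeta-z)^2}\,dm(\zeta).$$ **Proposition.** All these integrals, sums and limits exist (the series for $k^r$ converges absolutely at every point). For all $r>0$, $f\in\mathcal S$, $z\in\mathbb C$, $$(\mathcal K^rf)(z)=\sum_{n\in\mathbb Z}(\mathcal A^{2^nr}f)(z)$$ with absolute convergence, so that $S$ is the average of the Haar projections of type $0$ over all translated, rotated and dilated grids. Moreover there is a nonzero $c\in\mathbb R$ such that $Sf=cTf$ pointwise for every $f\in\mathcal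 S$, namely $$c=-\frac12\iint_{\mathbb R^2}F(x,y)\,\frac{x^2-y^2}{x^2+y^2}\,dx\,dy=4\cdot\frac1{12}\Big(\arctan2-4\arctan\tfrac12+\tfrac{15}8\log5-4\log2\Big),$$ and $|c/4+0.042|<0.0005$. -/

import Mathlib

open MeasureTheory Filter Topology Set
open scoped SchwartzMap

noncomputable section

namespace HaarAveraging

/-! The plane `ℝ²` is identified with `ℂ` (Euclidean norm, Lebesgue measure), and the rotation by
the angle `ψ` is multiplication by `exp (iψ)`. -/

/-- The characteristic function of `s ⊆ ℝ`. -/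
def chi (s : Set ℝ) (x : ℝ) : ℝ := s.indicator (fun _ => 1) x

/-- The Haar function `h_I = |I|^{-1/2} (χ_{I₊} - χ_{I₋})` of the interval `I = [a, a + ℓ)`. -/
def haarInterval (a l x : ℝ) : ℝ :=
  1 / √l * (chi (Ico (a + l / 2) (a + l)) x - chi (Ico a (a + l / 2)) x)

/-- The Haar function of type `0`, `h_Q⁰ = |I|^{-1/2} χ_I ⊗ h_J`, of the square `Q = I × J` of
side `ℓ` whose lower left vertex is `a`. -/
def haarSquare (a : ℂ) (l : ℝ) (z : ℂ) : ℝ :=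
  1 / √l * chi (Ico a.re (a.re + l)) z.re * haarInterval a.im l z.im

/-- The lower left vertex of the square with index `m` in the grid of size `ρ` and reference
point `t`. -/
def corner (ρ : ℝ) (t : ℂ) (m : ℤ × ℤ) : ℂ := t + (ρ : ℂ) * ((m.1 : ℂ) + (m.2 : ℂ) * Complex.I)

/-- The projection `f ↦ ∑_Q ⟨f, h_Q⁰⟩ h_Q⁰` over the squares `Q` of the grid of size `ρ` and
reference point `t`. At each point only one summand is nonzero. -/
def gridProjection (ρ : ℝ) (t : ℂ) (f : ℂ → ℂ) (z : ℂ) : ℂ :=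
  ∑' m : ℤ × ℤ, (∫ w : ℂ, f w * (haarSquare (corner ρ t m) ρ w : ℂ)) *
    (haarSquare (corner ρ t m) ρ z : ℂ)

/-- The set `[0, ρ) × [0, ρ)` of reference points of the grids of size `ρ`. -/
def refPoints (ρ : ℝ) : Set ℂ := Ico 0 ρ ×ℂ Ico 0 ρ

/-- The average of the projections over all translated grids of size `ρ`. -/
def translationAverage (ρ : ℝ) (f : ℂ → ℂ) (z : ℂ) : ℂ :=
  ((1 / ρ ^ 2 : ℝ) : ℂ) * ∫ t in refPoints ρ, gridProjection ρ t f z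

/-- Rotation of a function, `(U_ψ f)(z) = f (e^{-iψ} z)`; its inverse is `U_{-ψ}`. -/
def rot (ψ : ℝ) (f : ℂ → ℂ) (z : ℂ) : ℂ := f (Complex.exp (-(ψ : ℂ) * Complex.I) * z)

/-- The weight `e^{-2iψ}`. -/
def rotWeight (ψ : ℝ) : ℂ := Complex.exp (-2 * (ψ : ℂ) * Complex.I)

/-- The average of the projections over all translated and rotated grids of size `ρ`, with the
rotation weight `e^{-2iψ}`. -/
def rotationAverage (ρ : ℝ) (f : ℂ → ℂ) (z : ℂ) : ℂ :=
  ((1 / (2 * Real.pi) : ℝ) : ℂ) *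
    ∫ ψ in (0 : ℝ)..(2 * Real.pi), rot ψ (translationAverage ρ (rot (-ψ) f)) z * rotWeight ψ

/-- The characteristic function `χ₀` of `(-1/2, 1/2]`. -/
def chi0 (x : ℝ) : ℝ := chi (Ioc (-1 / 2) (1 / 2)) x

/-- The Haar function `h₀` of `(-1/2, 1/2]`. -/
def h0 (x : ℝ) : ℝ := chi (Ioc 0 (1 / 2)) x - chi (Ioc (-1 / 2) 0) x

/-- `α = h₀ * h₀`. -/
def alpha (x : ℝ) : ℝ := ∫ s : ℝ, h0 s * h0 (x - s)

/-- `β = χ₀ * χ₀`. -/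
def beta (x : ℝ) : ℝ := ∫ s : ℝ, chi0 s * chi0 (x - s)

/-- `F(x, y) = -β(x) α(y)`. -/
def kerF (z : ℂ) : ℝ := -(beta z.re * alpha z.im)

/-- `F^ρ(z) = ρ⁻² F(z / ρ)`. -/
def kerFScaled (ρ : ℝ) (z : ℂ) : ℂ := ((1 / ρ ^ 2 * kerF (z / (ρ : ℂ)) : ℝ) : ℂ)

/-- `G^ρ = (1 / 2π) ∫₀^{2π} (U_ψ F^ρ) e^{-2iψ} dψ`. -/
def kerG (ρ : ℝ) (z : ℂ) : ℂ :=
  ((1 / (2 * Real.pi) : ℝ) : ℂ) *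
    ∫ ψ in (0 : ℝ)..(2 * Real.pi), rot ψ (kerFScaled ρ) z * rotWeight ψ

/-- `k^r = ∑_{n ∈ ℤ} G^{2ⁿ r}`, the kernel for the lattices of calibre `r`. -/
def kerLattice (r : ℝ) (z : ℂ) : ℂ := ∑' n : ℤ, kerG ((2 : ℝ) ^ n * r) z

/-- The truncated integral `∫_{|y - a| > ε} g(y) dy`. -/
def truncIntegral (g : ℂ → ℂ) (a : ℂ) (ε : ℝ) : ℂ := ∫ y in {y : ℂ | ε < ‖y - a‖}, g y

/-- The principal value integral of `g`, singular at `a`, exists. -/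
def PVExists (g : ℂ → ℂ) (a : ℂ) : Prop :=
  (∀ ε > 0, IntegrableOn g {y : ℂ | ε < ‖y - a‖}) ∧
    ∃ L : ℂ, Tendsto (truncIntegral g a) (𝓝[>] 0) (𝓝 L)

/-- The principal value `lim_{ε → 0} ∫_{|y - a| > ε} g(y) dy` (meaningful if it exists). -/
def pv (g : ℂ → ℂ) (a : ℂ) : ℂ := limUnder (𝓝[>] 0) (truncIntegral g a)

/-- `(K^r f)(z) = p.v. ∫ k^r(y) f(z - y) dy`, the average over the lattices of calibre `r`. -/
def latticeAverage (r : ℝ) (f : ℂ → ℂ) (z : ℂ) : ℂ := pv (fun y => kerLattice r y * f (z - y)) 0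

/-- `(S f)(z) = ∫₁² (K^r f)(z) dr / r`, the average over all lattices. -/
def fullAverage (f : ℂ → ℂ) (z : ℂ) : ℂ :=
  ∫ r in (1 : ℝ)..2, latticeAverage r f z * ((1 / r : ℝ) : ℂ)

/-- The Ahlfors-Beurling transform `(T f)(z) = -(1/π) p.v. ∫ f(ζ) / (ζ - z)² dm(ζ)`. -/
def ahlforsBeurling (f : ℂ → ℂ) (z : ℂ) : ℂ :=
  -(1 / (Real.pi : ℂ)) * pv (fun ζ => f ζ / (ζ - z) ^ 2) z

end HaarAveraging

end

noncomputable section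

namespace HaarAveraging

/-! Averaging over translates turns the sum over a grid into a convolution. The lower left vertices
of all translated grids sweep the plane once, so the average has kernel the autocorrelation of one
Haar square, which is $F^\rho$ (`translationAverage_eq`). Rotating replaces $F^\rho$ by $G^\rho$
(`rotationAverage_eq_convolution`).

The weight $e^{-2i\psi}$ forces $G^\rho(iy)=-G^\rho(y)$, and $|G^\rho|\le\rho^{-2}$ is supported in
$|y|\le2\rho$, so the dyadic sum $k^r$ is $O(|y|^{-2})$ uniformly in $r$ and has the same
antisymmetry, as has $1/y^2$. For any such kernel $K$, averaging the substitutions $y$ and $iy$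
gives p.v. $\int K(y)f(z-y)\,dy=\frac12\int K(y)\,(f(z-y)-f(z-iy))\,dy$, where the right side
converges absolutely, because the difference is $O(|y|)$ at $0$ (`IsTurnKernel.pv_eq`). All
principal values disappear, and sums and integrals may be interchanged freely.

Integrating over $r\in[1,2]$ against $dr/r$ and summing over $n$ glues the dyadic scales into
$\int_0^\infty G^\rho(y)\,d\rho/\rho$. By scaling this is homogeneous of degree $-2$, with angular
dependence $e^{-2i\arg y}$, hence a multiple of $1/y^2$ (`integral_kerG_div`). The factor is
$\frac1{2\pi}\int F(w)(w/|w|)^2\,dw$; comparison with the normalisation $-1/\pi$ of $T$ gives $c$.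
Elementary primitives evaluate this integral, and a numerical bracket shows that it is nonzero. -/

/-! ### Autocorrelations of intervals, Haar functions and Haar squares -/

/-- The triangle function `max(0, 1 - |x|)`. -/
def tri (x : ℝ) : ℝ := max 0 (1 - |x|)

lemma tri_neg (x : ℝ) : tri (-x) = tri x := by simp [tri]

lemma tri_nonneg (x : ℝ) : 0 ≤ tri x := le_max_left _ _

lemma tri_le_one (x : ℝ) : tri x ≤ 1 := by
  have := abs_nonneg x
  exact max_le zero_le_one (by linarith)

lemma tri_of_one_le {x : ℝ} (hx : 1 ≤ |x|) : tri x = 0 := max_eq_left (by linarith)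

lemma continuous_tri : Continuous tri := by unfold tri; fun_prop

lemma chi_mem {s : Set ℝ} {x : ℝ} (h : x ∈ s) : chi s x = 1 := indicator_of_mem h _

lemma chi_notMem {s : Set ℝ} {x : ℝ} (h : x ∉ s) : chi s x = 0 := indicator_of_notMem h _

lemma chi_congr {s t : Set ℝ} {x y : ℝ} (h : x ∈ s ↔ y ∈ t) : chi s x = chi t y := by
  by_cases hx : x ∈ s
  · rw [chi_mem hx, chi_mem (h.1 hx)]
  · rw [chi_notMem hx, chi_notMem (fun hy => hx (h.2 hy))]

lemma chi_nonneg (s : Set ℝ) (x : ℝ) : 0 ≤ chi s x := by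
  by_cases hx : x ∈ s
  · rw [chi_mem hx]; exact zero_le_one
  · rw [chi_notMem hx]

lemma chi_le_one (s : Set ℝ) (x : ℝ) : chi s x ≤ 1 := by
  by_cases hx : x ∈ s
  · rw [chi_mem hx]
  · rw [chi_notMem hx]; exact zero_le_one

lemma measurable_chi {s : Set ℝ} (hs : MeasurableSet s) : Measurable (chi s) :=
  measurable_const.indicator hs

lemma chi_mul_chi (s t : Set ℝ) (x : ℝ) : chi s x * chi t x = chi (s ∩ t) x := by
  by_cases hs : x ∈ s <;> by_cases ht : x ∈ t <;> simp [chi, hs, ht]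

lemma integrable_chi_Ioc (a b : ℝ) : Integrable (chi (Ioc a b)) :=
  (integrable_indicator_iff measurableSet_Ioc).2 (integrableOn_const (by simp))

lemma integrable_chi_Ioc_mul (a b c d : ℝ) :
    Integrable (fun x => chi (Ioc a b) x * chi (Ioc c d) x) := by
  simp only [chi_mul_chi, Ioc_inter_Ioc]
  exact integrable_chi_Ioc _ _

lemma integral_chi_Ioc_mul {l : ℝ} (hl : 0 < l) (p q : ℝ) :
    ∫ x, chi (Ioc p (p + l)) x * chi (Ioc q (q + l)) x = l * tri ((p - q) / l) := by
  have h1 : ∀ s : Set ℝ, MeasurableSet s → ∫ x, chi s x = volume.real s := fun s hs => by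
    simp [chi, integral_indicator hs]
  simp only [chi_mul_chi, Ioc_inter_Ioc]
  rw [h1 _ measurableSet_Ioc, Measure.real, Real.volume_Ioc, ENNReal.toReal_ofReal', tri,
    mul_max_of_nonneg _ _ hl.le, abs_div, abs_of_pos hl, mul_sub, mul_div_cancel₀ _ hl.ne', mul_one,
    mul_zero, max_comm]
  congr 1
  rcases le_total p q with h | h
  · rw [min_eq_left (by linarith), max_eq_right h, abs_of_nonpos (by linarith)]; ring
  · rw [min_eq_right (by linarith), max_eq_left h, abs_of_nonneg (by linarith)]; ring

/-- Reflection exchanges the open and closed ends, so equality with a left-open interval holds only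
almost everywhere; this suffices under the integral. -/
lemma chi_Ioc_sub_ae (p q x : ℝ) :
    (fun s => chi (Ioc p q) (x - s)) =ᵐ[volume] chi (Ioc (x - q) (x - p)) := by
  have h : (fun s => chi (Ioc p q) (x - s)) = chi (Ico (x - q) (x - p)) := by
    funext s
    refine chi_congr ?_
    simp only [mem_Ioc, mem_Ico]
    constructor <;> rintro ⟨h1, h2⟩ <;> constructor <;> linarith
  rw [h]
  exact indicator_ae_eq_of_ae_eq_set Ico_ae_eq_Ioc

lemma integrable_chi_Ioc_mul_sub (p q r s x : ℝ) :
    Integrable (fun y => chi (Ioc p q) y * chi (Ioc r s) (x - y)) := by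
  refine (integrable_chi_Ioc_mul p q (x - s) (x - r)).congr ?_
  filter_upwards [chi_Ioc_sub_ae r s x] with y hy
  rw [hy]

lemma integral_chi_Ioc_mul_sub {l : ℝ} (hl : 0 < l) (p q x : ℝ) :
    ∫ s, chi (Ioc p (p + l)) s * chi (Ioc q (q + l)) (x - s)
      = l * tri ((p + q + l - x) / l) := by
  rw [show p + q + l - x = p - (x - (q + l)) by ring, ← integral_chi_Ioc_mul hl]
  refine integral_congr_ae ?_
  filter_upwards [chi_Ioc_sub_ae q (q + l) x] with y hy
  rw [hy, show x - (q + l) + l = x - q by ring]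

lemma beta_eq (x : ℝ) : beta x = tri x := by
  have h := integral_chi_Ioc_mul_sub one_pos (-1 / 2) (-1 / 2) x
  norm_num at h
  simp only [beta, chi0]
  norm_num
  rw [h, tri_neg]

/-- Each pair of half-intervals contributes a triangle of half-width $1/2$; the two mixed pairs give
the same one, with negative sign. -/
lemma alpha_eq (x : ℝ) : alpha x = (tri (2 * x - 1) + tri (2 * x + 1)) / 2 - tri (2 * x) := by
  have hl : (0 : ℝ) < 1 / 2 := by norm_num
  have e1 := integral_chi_Ioc_mul_sub hl 0 0 x
  have e2 := integral_chi_Ioc_mul_sub hl (-1 / 2) 0 x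
  have e3 := integral_chi_Ioc_mul_sub hl 0 (-1 / 2) x
  have e4 := integral_chi_Ioc_mul_sub hl (-1 / 2) (-1 / 2) x
  rw [show (0 : ℝ) + 1 / 2 = 1 / 2 by norm_num] at e1 e2 e3
  rw [show (-1 / 2 : ℝ) + 1 / 2 = 0 by norm_num] at e2 e3 e4
  have key : ∀ s, h0 s * h0 (x - s) =
      chi (Ioc 0 (1 / 2)) s * chi (Ioc 0 (1 / 2)) (x - s)
      - chi (Ioc (-1 / 2) 0) s * chi (Ioc 0 (1 / 2)) (x - s)
      - chi (Ioc 0 (1 / 2)) s * chi (Ioc (-1 / 2) 0) (x - s)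
      + chi (Ioc (-1 / 2) 0) s * chi (Ioc (-1 / 2) 0) (x - s) := fun s => by
    simp only [h0]; ring
  simp only [alpha, key]
  rw [integral_add _ (integrable_chi_Ioc_mul_sub _ _ _ _ _), integral_sub _
    (integrable_chi_Ioc_mul_sub _ _ _ _ _), integral_sub (integrable_chi_Ioc_mul_sub _ _ _ _ _)
    (integrable_chi_Ioc_mul_sub _ _ _ _ _), e1, e2, e3, e4,
    show (0 + 0 + 1 / 2 - x) / (1 / 2) = -(2 * x - 1) by ring,
    show (-1 / 2 + 0 + 1 / 2 - x) / (1 / 2) = -(2 * x) by ring,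
    show (0 + -1 / 2 + 1 / 2 - x) / (1 / 2) = -(2 * x) by ring,
    show (-1 / 2 + -1 / 2 + 1 / 2 - x) / (1 / 2) = -(2 * x + 1) by ring]
  · simp only [tri_neg]; ring
  · exact (integrable_chi_Ioc_mul_sub _ _ _ _ _).sub (integrable_chi_Ioc_mul_sub _ _ _ _ _)
  · exact ((integrable_chi_Ioc_mul_sub _ _ _ _ _).sub (integrable_chi_Ioc_mul_sub _ _ _ _ _)).sub
      (integrable_chi_Ioc_mul_sub _ _ _ _ _)

lemma beta_neg (x : ℝ) : beta (-x) = beta x := by rw [beta_eq, beta_eq, tri_neg]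

lemma alpha_neg (x : ℝ) : alpha (-x) = alpha x := by
  rw [alpha_eq, alpha_eq, show 2 * -x - 1 = -(2 * x + 1) by ring,
    show 2 * -x + 1 = -(2 * x - 1) by ring, show 2 * -x = -(2 * x) by ring]
  simp only [tri_neg]
  ring

lemma continuous_beta : Continuous beta := by
  rw [funext beta_eq]; exact continuous_tri

lemma continuous_alpha : Continuous alpha := by
  rw [funext alpha_eq]
  have := continuous_tri
  fun_prop

lemma abs_beta_le (x : ℝ) : |beta x| ≤ 1 := by
  rw [beta_eq, abs_of_nonneg (tri_nonneg x)]; exact tri_le_one x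

lemma abs_alpha_le (x : ℝ) : |alpha x| ≤ 1 := by
  rw [alpha_eq, abs_le]
  have h1 := tri_nonneg (2 * x - 1)
  have h2 := tri_nonneg (2 * x + 1)
  have h3 := tri_nonneg (2 * x)
  have h4 := tri_le_one (2 * x - 1)
  have h5 := tri_le_one (2 * x + 1)
  have h6 := tri_le_one (2 * x)
  constructor <;> linarith

lemma beta_of_one_le {x : ℝ} (hx : 1 ≤ |x|) : beta x = 0 := by rw [beta_eq, tri_of_one_le hx]

lemma alpha_of_one_le {x : ℝ} (hx : 1 ≤ |x|) : alpha x = 0 := by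
  have h1 : 1 ≤ |2 * x - 1| := by
    rcases le_abs.1 hx with h | h
    · exact le_abs.2 (Or.inl (by linarith))
    · exact le_abs.2 (Or.inr (by linarith))
  have h2 : 1 ≤ |2 * x + 1| := by
    rcases le_abs.1 hx with h | h
    · exact le_abs.2 (Or.inl (by linarith))
    · exact le_abs.2 (Or.inr (by linarith))
  have h3 : 1 ≤ |2 * x| := by
    rw [abs_mul, abs_two]; linarith
  rw [alpha_eq, tri_of_one_le h1, tri_of_one_le h2, tri_of_one_le h3]
  norm_num

lemma continuous_kerF : Continuous kerF := by
  unfold kerF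
  have := continuous_beta
  have := continuous_alpha
  fun_prop

lemma abs_kerF_le (z : ℂ) : |kerF z| ≤ 1 := by
  rw [kerF, abs_neg, abs_mul]
  exact mul_le_one₀ (abs_beta_le _) (abs_nonneg _) (abs_alpha_le _)

lemma kerF_of_two_le {z : ℂ} (hz : 2 ≤ ‖z‖) : kerF z = 0 := by
  rw [kerF]
  by_cases h1 : 1 ≤ |z.re|
  · rw [beta_of_one_le h1]; simp
  · have := Complex.norm_le_abs_re_add_abs_im z
    rw [alpha_of_one_le (by linarith : 1 ≤ |z.im|)]; simp

/-- For fixed $x$, the Haar value is read as a function of the left endpoint $a$, the variable that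
the translation average integrates. -/
lemma haarInterval_eq (a l x : ℝ) : haarInterval a l x =
    1 / √l * (chi (Ioc (x - l) (x - l / 2)) a - chi (Ioc (x - l / 2) x) a) := by
  rw [haarInterval]
  congr 2
  · refine chi_congr ?_
    simp only [mem_Ioc, mem_Ico]
    constructor <;> rintro ⟨h1, h2⟩ <;> constructor <;> linarith
  · refine chi_congr ?_
    simp only [mem_Ioc, mem_Ico]
    constructor <;> rintro ⟨h1, h2⟩ <;> constructor <;> linarith

lemma chi_Ico_add_eq (a l x : ℝ) : chi (Ico a (a + l)) x = chi (Ioc (x - l) x) a := by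
  refine chi_congr ?_
  simp only [mem_Ioc, mem_Ico]
  constructor <;> rintro ⟨h1, h2⟩ <;> constructor <;> linarith

lemma integral_chi_Ico_mul {l : ℝ} (hl : 0 < l) (p q : ℝ) :
    ∫ a, (1 / √l * chi (Ico a (a + l)) p) * (1 / √l * chi (Ico a (a + l)) q)
      = beta ((p - q) / l) := by
  have h : ∀ a, (1 / √l * chi (Ico a (a + l)) p) * (1 / √l * chi (Ico a (a + l)) q) =
      l⁻¹ * (chi (Ioc (p - l) (p - l + l)) a * chi (Ioc (q - l) (q - l + l)) a) := fun a => by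
    rw [chi_Ico_add_eq, chi_Ico_add_eq, sub_add_cancel, sub_add_cancel]
    have := Real.mul_self_sqrt hl.le
    rw [mul_mul_mul_comm, div_mul_div_comm, this]; ring
  simp only [h]
  rw [integral_const_mul, integral_chi_Ioc_mul hl, beta_eq, sub_sub_sub_cancel_right,
    inv_mul_cancel_left₀ hl.ne']

/-- The integral is an autocorrelation while `alpha` is a self-convolution. The Haar function is odd
about its centre up to endpoints, whence the minus sign, which is also the one in $F$. -/
lemma integral_haarInterval_mul {l : ℝ} (hl : 0 < l) (p q : ℝ) :
    ∫ a, haarInterval a l p * haarInterval a l q = -alpha ((p - q) / l) := by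
  have hl2 : 0 < l / 2 := by positivity
  have h : ∀ a, haarInterval a l p * haarInterval a l q =
      l⁻¹ * (chi (Ioc (p - l) (p - l / 2)) a * chi (Ioc (q - l) (q - l / 2)) a
      - chi (Ioc (p - l / 2) p) a * chi (Ioc (q - l) (q - l / 2)) a
      - chi (Ioc (p - l) (p - l / 2)) a * chi (Ioc (q - l / 2) q) a
      + chi (Ioc (p - l / 2) p) a * chi (Ioc (q - l / 2) q) a) := fun a => by
    rw [haarInterval_eq, haarInterval_eq]
    have := Real.mul_self_sqrt hl.le
    rw [mul_mul_mul_comm, div_mul_div_comm, this]; ring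
  have e1 := integral_chi_Ioc_mul hl2 (p - l) (q - l)
  have e2 := integral_chi_Ioc_mul hl2 (p - l / 2) (q - l)
  have e3 := integral_chi_Ioc_mul hl2 (p - l) (q - l / 2)
  have e4 := integral_chi_Ioc_mul hl2 (p - l / 2) (q - l / 2)
  rw [show p - l + l / 2 = p - l / 2 by ring] at e1 e3
  rw [show q - l + l / 2 = q - l / 2 by ring] at e1 e2
  rw [sub_add_cancel] at e2 e3 e4
  rw [sub_add_cancel] at e4
  simp only [h]
  rw [integral_const_mul, integral_add _ (integrable_chi_Ioc_mul _ _ _ _), integral_sub _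
    (integrable_chi_Ioc_mul _ _ _ _), integral_sub (integrable_chi_Ioc_mul _ _ _ _)
    (integrable_chi_Ioc_mul _ _ _ _), e1, e2, e3, e4, alpha_eq,
    show (p - l - (q - l)) / (l / 2) = 2 * ((p - q) / l) by field_simp; ring,
    show (p - l / 2 - (q - l)) / (l / 2) = 2 * ((p - q) / l) + 1 by field_simp; ring,
    show (p - l - (q - l / 2)) / (l / 2) = 2 * ((p - q) / l) - 1 by field_simp; ring,
    show (p - l / 2 - (q - l / 2)) / (l / 2) = 2 * ((p - q) / l) by field_simp; ring]
  · field_simp; ring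
  · exact (integrable_chi_Ioc_mul _ _ _ _).sub (integrable_chi_Ioc_mul _ _ _ _)
  · exact ((integrable_chi_Ioc_mul _ _ _ _).sub (integrable_chi_Ioc_mul _ _ _ _)).sub
      (integrable_chi_Ioc_mul _ _ _ _)

lemma integral_complex_re_mul_im {𝕜 : Type*} [RCLike 𝕜] (f g : ℝ → 𝕜) :
    ∫ z : ℂ, f z.re * g z.im = (∫ x, f x) * ∫ y, g y := by
  rw [← integral_prod_mul]
  exact Complex.volume_preserving_equiv_real_prod.integral_comp
    Complex.measurableEquivRealProd.measurableEmbedding (fun p : ℝ × ℝ => f p.1 * g p.2)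

/-- The reproducing kernel of the translation average. -/
lemma integral_haarSquare_mul {l : ℝ} (hl : 0 < l) (w z : ℂ) :
    ∫ s : ℂ, haarSquare s l w * haarSquare s l z = kerF ((z - w) / (l : ℂ)) := by
  have h : ∀ s : ℂ, haarSquare s l w * haarSquare s l z =
      ((1 / √l * chi (Ico s.re (s.re + l)) z.re) * (1 / √l * chi (Ico s.re (s.re + l)) w.re)) *
      (haarInterval s.im l z.im * haarInterval s.im l w.im) := fun s => by
    simp only [haarSquare]; ring
  simp only [h]
  rw [integral_complex_re_mul_im
    (fun a => (1 / √l * chi (Ico a (a + l)) z.re) * (1 / √l * chi (Ico a (a + l)) w.re))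
    (fun a => haarInterval a l z.im * haarInterval a l w.im),
    integral_chi_Ico_mul hl, integral_haarInterval_mul hl, kerF, Complex.div_ofReal_re,
    Complex.div_ofReal_im, Complex.sub_re, Complex.sub_im]
  ring

/-! ### Size and quarter-turn antisymmetry of the kernels -/

/-- The envelope `ρ⁻² χ_{R ≤ 2ρ}` of the kernels of scale `ρ` on the circle of radius `R`. -/
def envelope (ρ R : ℝ) : ℝ := if R ≤ 2 * ρ then 1 / ρ ^ 2 else 0

lemma envelope_nonneg (ρ R : ℝ) : 0 ≤ envelope ρ R := by
  unfold envelope; split_ifs <;> positivity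

lemma summable_envelope {r R : ℝ} (hr : 0 < r) (hR : 0 < R) :
    Summable (fun n : ℤ => envelope ((2 : ℝ) ^ n * r) R) ∧
      ∑' n : ℤ, envelope ((2 : ℝ) ^ n * r) R ≤ 6 / R ^ 2 := by
  -- $N$ is the last scale whose disc of radius $2\cdot2^Nr$ misses the circle of radius $R$. Scales
  -- up to $N$ contribute nothing, and from $N+1$ on the terms are at most $4R^{-2}4^{-k}$, with sum
  -- $\frac{16}3R^{-2}\le6R^{-2}$.
  obtain ⟨N, hN1, hN2⟩ := exists_mem_Ioc_zpow (show 0 < R / (2 * r) by positivity) one_lt_two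
  rw [lt_div_iff₀ (by positivity)] at hN1
  rw [div_le_iff₀ (by positivity)] at hN2
  have hinj : Function.Injective (fun k : ℕ => N + 1 + (k : ℤ)) := fun a b h => by
    simpa using h
  have hzero : ∀ n : ℤ, n ∉ range (fun k : ℕ => N + 1 + (k : ℤ)) →
      envelope ((2 : ℝ) ^ n * r) R = 0 := fun n hn => by
    have hle : n ≤ N := by
      by_contra! h
      refine hn ⟨(n - N - 1).toNat, ?_⟩
      simp only
      omega
    have := zpow_le_zpow_right₀ (one_le_two (α := ℝ)) hle
    rw [envelope, if_neg]
    nlinarith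
  have hbd : ∀ k : ℕ, envelope ((2 : ℝ) ^ (N + 1 + (k : ℤ)) * r) R ≤
      4 / R ^ 2 * (1 / 4) ^ k := fun k => by
    refine (show envelope _ R ≤ 1 / ((2 : ℝ) ^ (N + 1 + (k : ℤ)) * r) ^ 2 by
      unfold envelope; split_ifs; exacts [le_rfl, by positivity]).trans ?_
    have h4 : (4 : ℝ) ^ k = (2 ^ k) ^ 2 := by rw [← pow_mul, mul_comm, pow_mul]; norm_num
    rw [zpow_add₀ two_ne_zero, zpow_natCast, one_div_pow, div_mul_div_comm, mul_one,
      div_le_div_iff₀ (by positivity) (by positivity), h4]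
    have : R ^ 2 ≤ ((2 : ℝ) ^ (N + 1) * (2 * r)) ^ 2 := pow_le_pow_left₀ hR.le hN2 2
    have h2k : (0 : ℝ) ≤ (2 ^ k) ^ 2 := by positivity
    nlinarith [mul_le_mul_of_nonneg_right this h2k]
  have hgeo : Summable (fun k : ℕ => 4 / R ^ 2 * (1 / 4 : ℝ) ^ k) :=
    (summable_geometric_of_lt_one (by norm_num) (by norm_num)).mul_left _
  have hs : Summable (fun k : ℕ => envelope ((2 : ℝ) ^ (N + 1 + (k : ℤ)) * r) R) :=
    hgeo.of_nonneg_of_le (fun _ => envelope_nonneg _ _) hbd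
  refine ⟨(hinj.summable_iff hzero).1 hs, ?_⟩
  rw [← hinj.tsum_eq (Function.support_subset_iff'.2 hzero)]
  refine (hs.tsum_le_tsum hbd hgeo).trans ?_
  rw [tsum_mul_left, tsum_geometric_of_lt_one (by norm_num) (by norm_num), div_mul_eq_mul_div]
  gcongr
  norm_num

lemma norm_exp_neg_mul_I (ψ : ℝ) : ‖Complex.exp (-(ψ : ℂ) * Complex.I)‖ = 1 := by
  rw [← Complex.ofReal_neg, Complex.norm_exp_ofReal_mul_I]

lemma norm_rotWeight (ψ : ℝ) : ‖rotWeight ψ‖ = 1 := by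
  rw [rotWeight, show (-2 * (ψ : ℂ) * Complex.I) = ((-2 * ψ : ℝ) : ℂ) * Complex.I by push_cast; ring,
    Complex.norm_exp_ofReal_mul_I]

lemma continuous_rotWeight : Continuous rotWeight := by unfold rotWeight; fun_prop

lemma measurable_kerFScaled : Measurable (fun p : ℝ × ℂ => kerFScaled p.1 p.2) := by
  unfold kerFScaled
  have := continuous_kerF.measurable
  fun_prop

lemma norm_kerFScaled_le {ρ : ℝ} (hρ : 0 < ρ) (z : ℂ) :
    ‖kerFScaled ρ z‖ ≤ envelope ρ ‖z‖ := by
  rw [kerFScaled, Complex.norm_real, norm_mul, Real.norm_of_nonneg (by positivity),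
    Real.norm_eq_abs, envelope]
  split_ifs with h
  · exact mul_le_of_le_one_right (by positivity) (abs_kerF_le _)
  · rw [kerF_of_two_le, abs_zero, mul_zero]
    rw [norm_div, Complex.norm_real, Real.norm_of_nonneg hρ.le, le_div_iff₀ hρ]
    linarith

lemma measurable_rot_kerFScaled :
    Measurable (fun p : (ℝ × ℂ) × ℝ => rot p.2 (kerFScaled p.1.1) p.1.2 * rotWeight p.2) := by
  have h1 : Measurable (fun p : (ℝ × ℂ) × ℝ =>
      (p.1.1, Complex.exp (-(p.2 : ℂ) * Complex.I) * p.1.2)) := by fun_prop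
  have h2 : Measurable (fun p : (ℝ × ℂ) × ℝ => rotWeight p.2) :=
    continuous_rotWeight.measurable.comp measurable_snd
  exact (measurable_kerFScaled.comp h1).mul h2

lemma norm_rot_kerFScaled_le {ρ : ℝ} (hρ : 0 < ρ) (ψ : ℝ) (z : ℂ) :
    ‖rot ψ (kerFScaled ρ) z * rotWeight ψ‖ ≤ envelope ρ ‖z‖ := by
  rw [norm_mul, norm_rotWeight, mul_one, rot]
  refine (norm_kerFScaled_le hρ _).trans ?_
  rw [norm_mul, norm_exp_neg_mul_I, one_mul]

lemma measurable_kerG : Measurable (fun p : ℝ × ℂ => kerG p.1 p.2) := by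
  unfold kerG
  simp only [intervalIntegral.integral_of_le Real.two_pi_pos.le]
  refine measurable_const.mul ?_
  exact (measurable_rot_kerFScaled.stronglyMeasurable.integral_prod_right'
    (ν := volume.restrict (Ioc 0 (2 * Real.pi)))).measurable

lemma norm_kerG_le {ρ : ℝ} (hρ : 0 < ρ) (z : ℂ) : ‖kerG ρ z‖ ≤ envelope ρ ‖z‖ := by
  have hpi := Real.two_pi_pos
  have h := intervalIntegral.norm_integral_le_of_norm_le_const (a := 0) (b := 2 * Real.pi)
    (fun ψ _ => norm_rot_kerFScaled_le hρ ψ z)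
  rw [sub_zero, abs_of_pos hpi] at h
  rw [kerG, norm_mul, Complex.norm_real, Real.norm_of_nonneg (by positivity)]
  calc _ ≤ 1 / (2 * Real.pi) * (envelope ρ ‖z‖ * (2 * Real.pi)) := by gcongr
    _ = _ := by field_simp

lemma rot_mul_rotWeight_periodic (g : ℂ → ℂ) (z : ℂ) :
    Function.Periodic (fun ψ : ℝ => rot ψ g z * rotWeight ψ) (2 * Real.pi) := fun ψ => by
  have h1 : Complex.exp (-((ψ + 2 * Real.pi : ℝ) : ℂ) * Complex.I) =
      Complex.exp (-(ψ : ℂ) * Complex.I) := by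
    rw [Complex.exp_eq_exp_iff_exists_int]
    exact ⟨-1, by push_cast; ring⟩
  have h2 : rotWeight (ψ + 2 * Real.pi) = rotWeight ψ := by
    rw [rotWeight, rotWeight, Complex.exp_eq_exp_iff_exists_int]
    exact ⟨-2, by push_cast; ring⟩
  simp only [rot, h1, h2]

/-- Replacing $z$ by $iz$ shifts $\psi$ by $\pi/2$, and the weight $e^{-2i\psi}$ changes sign under
this shift. -/
lemma kerG_I_mul (ρ : ℝ) (z : ℂ) : kerG ρ (Complex.I * z) = -kerG ρ z := by
  have h : ∀ ψ : ℝ, rot ψ (kerFScaled ρ) (Complex.I * z) * rotWeight ψ =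
      -(rot (ψ - Real.pi / 2) (kerFScaled ρ) z * rotWeight (ψ - Real.pi / 2)) := fun ψ => by
    have h1 : Complex.exp (-((ψ - Real.pi / 2 : ℝ) : ℂ) * Complex.I) =
        Complex.exp (-(ψ : ℂ) * Complex.I) * Complex.I := by
      rw [show -((ψ - Real.pi / 2 : ℝ) : ℂ) * Complex.I =
        -(ψ : ℂ) * Complex.I + Real.pi / 2 * Complex.I by push_cast; ring, Complex.exp_add,
        Complex.exp_pi_div_two_mul_I]
    have h2 : rotWeight (ψ - Real.pi / 2) = -rotWeight ψ := by
      rw [rotWeight, rotWeight, show -2 * ((ψ - Real.pi / 2 : ℝ) : ℂ) * Complex.I =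
        -2 * (ψ : ℂ) * Complex.I + Real.pi * Complex.I by push_cast; ring, Complex.exp_add,
        Complex.exp_pi_mul_I, mul_neg_one]
    rw [rot, rot, h1, h2, mul_assoc]; ring
  -- By periodicity the shifted window $[-\pi/2,3\pi/2]$ may be moved back to $[0,2\pi]$.
  have e := (rot_mul_rotWeight_periodic (kerFScaled ρ) z).intervalIntegral_add_eq
    (0 - Real.pi / 2) 0
  rw [show 0 - Real.pi / 2 + 2 * Real.pi = 2 * Real.pi - Real.pi / 2 by ring, zero_add] at e
  unfold kerG
  simp only [h]
  rw [intervalIntegral.integral_neg,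
    intervalIntegral.integral_comp_sub_right (fun ψ => rot ψ (kerFScaled ρ) z * rotWeight ψ),
    mul_neg, e]

lemma kerG_zero (ρ : ℝ) : kerG ρ 0 = 0 := by
  have h := kerG_I_mul ρ 0
  rw [mul_zero] at h
  exact self_eq_neg.1 h

lemma summable_norm_kerG {r : ℝ} (hr : 0 < r) (z : ℂ) :
    Summable (fun n : ℤ => ‖kerG ((2 : ℝ) ^ n * r) z‖) ∧
      ∑' n : ℤ, ‖kerG ((2 : ℝ) ^ n * r) z‖ ≤ 6 / ‖z‖ ^ 2 := by
  -- At the origin every term vanishes by antisymmetry, and the bound reads $0\le6/0=0$.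
  rcases eq_or_ne z 0 with rfl | hz
  · simp [kerG_zero]
  have hz' : 0 < ‖z‖ := norm_pos_iff.2 hz
  obtain ⟨h1, h2⟩ := summable_envelope hr hz'
  have hle : ∀ n : ℤ, ‖kerG ((2 : ℝ) ^ n * r) z‖ ≤ envelope ((2 : ℝ) ^ n * r) ‖z‖ :=
    fun n => norm_kerG_le (by positivity) z
  have h3 := h1.of_nonneg_of_le (fun _ => norm_nonneg _) hle
  exact ⟨h3, (h3.tsum_le_tsum hle h1).trans h2⟩

lemma summable_kerG {r : ℝ} (hr : 0 < r) (z : ℂ) :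
    Summable (fun n : ℤ => kerG ((2 : ℝ) ^ n * r) z) := (summable_norm_kerG hr z).1.of_norm

lemma norm_kerLattice_le {r : ℝ} (hr : 0 < r) (z : ℂ) : ‖kerLattice r z‖ ≤ 6 / ‖z‖ ^ 2 :=
  (norm_tsum_le_tsum_norm (summable_norm_kerG hr z).1).trans (summable_norm_kerG hr z).2

lemma measurable_kerG_comp {X : Type*} [MeasurableSpace X] {a : X → ℝ} {b : X → ℂ}
    (ha : Measurable a) (hb : Measurable b) : Measurable (fun x => kerG (a x) (b x)) := by
  have h := measurable_kerG.comp (ha.prodMk hb)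
  simpa only [Function.comp_def] using h

lemma measurable_kerG_zpow (n : ℤ) :
    Measurable (fun p : ℝ × ℂ => kerG ((2 : ℝ) ^ n * p.1) p.2) :=
  measurable_kerG_comp (measurable_fst.const_mul ((2 : ℝ) ^ n)) measurable_snd

lemma measurable_kerLattice : Measurable (fun p : ℝ × ℂ => kerLattice p.1 p.2) :=
  Measurable.tsum measurable_kerG_zpow

lemma kerLattice_I_mul (r : ℝ) (z : ℂ) : kerLattice r (Complex.I * z) = -kerLattice r z := by
  simp only [kerLattice, kerG_I_mul, tsum_neg]

/-! ### Principal values of kernels that are odd under a quarter turn -/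

/-- The difference of a function along a quarter turn about `z`. -/
def turnDiff (f : ℂ → ℂ) (z y : ℂ) : ℂ := f (z - y) - f (z - Complex.I * y)

lemma measurePreserving_I_mul : MeasurePreserving (fun z : ℂ => Complex.I * z) := by
  have h := (rotation (Circle.exp (Real.pi / 2))).measurePreserving
  convert h using 1
  funext z
  rw [rotation_apply, Circle.coe_exp, Complex.ofReal_div, Complex.ofReal_ofNat,
    Complex.exp_pi_div_two_mul_I]

lemma measurableEmbedding_I_mul : MeasurableEmbedding (fun z : ℂ => Complex.I * z) :=
  (Homeomorph.mulLeft₀ Complex.I Complex.I_ne_zero).measurableEmbedding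

lemma exists_lipschitz_schwartz (f : 𝓢(ℂ, ℂ)) :
    ∃ L : ℝ, 0 < L ∧ ∀ x y : ℂ, ‖f x - f y‖ ≤ L * ‖x - y‖ := by
  obtain ⟨L, hL, h⟩ := f.decay 0 1
  refine ⟨L, hL, fun x y => ?_⟩
  refine convex_univ.norm_image_sub_le_of_norm_fderiv_le (𝕜 := ℝ) (fun x _ => f.differentiable x)
    (fun x _ => ?_) (mem_univ _) (mem_univ _)
  have := h x
  rwa [pow_zero, one_mul, norm_iteratedFDeriv_one] at this

lemma norm_turnDiff_le {f : ℂ → ℂ} {L : ℝ} (hf : ∀ x y : ℂ, ‖f x - f y‖ ≤ L * ‖x - y‖)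
    (hL : 0 ≤ L) (z y : ℂ) : ‖turnDiff f z y‖ ≤ 2 * L * ‖y‖ := by
  refine (hf _ _).trans ?_
  rw [show z - y - (z - Complex.I * y) = Complex.I * y - y by ring]
  have := norm_sub_le (Complex.I * y) y
  rw [norm_mul, Complex.norm_I, one_mul] at this
  nlinarith

lemma continuous_turnDiff {f : ℂ → ℂ} (hf : Continuous f) (z : ℂ) :
    Continuous (turnDiff f z) := by
  unfold turnDiff; fun_prop

lemma integrable_comp_sub_I_mul {f : ℂ → ℂ} (hf : Integrable f) (z : ℂ) :
    Integrable (fun y => f (z - Complex.I * y)) :=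
  (measurePreserving_I_mul.integrable_comp_emb measurableEmbedding_I_mul).2 (hf.comp_sub_left z)

lemma integrable_turnDiff {f : ℂ → ℂ} (hf : Integrable f) (z : ℂ) :
    Integrable (turnDiff f z) :=
  (hf.comp_sub_left z).sub (integrable_comp_sub_I_mul hf z)

/-- The Lipschitz bound makes the integrand $O(|y|^{-1})$ near $0$, which is integrable in dimension
two; outside the unit disc the integrable difference itself dominates. -/
lemma integrable_turnDiff_div (f : 𝓢(ℂ, ℂ)) (z : ℂ) :
    Integrable (fun y => ‖turnDiff f z y‖ / ‖y‖ ^ 2) := by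
  obtain ⟨L, hL, hf⟩ := exists_lipschitz_schwartz f
  have hmeas : Measurable (fun y => ‖turnDiff f z y‖ / ‖y‖ ^ 2) := by
    have := (continuous_turnDiff f.continuous z).measurable
    fun_prop
  have h1 : IntegrableOn (fun y => ‖turnDiff f z y‖ / ‖y‖ ^ 2) (Metric.ball 0 1) := by
    refine integrableOn_ball_of_norm_le_rpow (C := 2 * L) (α := 1) ?_ ?_ ?_
      hmeas.aestronglyMeasurable
    · simp
    · simp
    · refine Eventually.of_forall fun y => ?_
      rw [Real.norm_of_nonneg (by positivity), Real.rpow_neg_one]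
      rcases eq_or_ne y 0 with rfl | hy
      · simp
      have hy' : 0 < ‖y‖ := norm_pos_iff.2 hy
      rw [div_le_iff₀ (by positivity)]
      refine (norm_turnDiff_le hf hL.le z y).trans_eq ?_
      field_simp
  have h2 : IntegrableOn (fun y => ‖turnDiff f z y‖ / ‖y‖ ^ 2) (Metric.ball 0 1)ᶜ := by
    refine Integrable.mono' (integrable_turnDiff f.integrable z).norm.integrableOn
      hmeas.aestronglyMeasurable ?_
    refine (ae_restrict_mem Metric.isOpen_ball.measurableSet.compl).mono fun y hy => ?_
    rw [mem_compl_iff, mem_ball_zero_iff, not_lt] at hy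
    rw [Real.norm_of_nonneg (by positivity)]
    exact div_le_self (norm_nonneg _) (one_le_pow₀ hy)
  rw [← integrableOn_univ, ← union_compl_self (Metric.ball (0 : ℂ) 1)]
  exact h1.union h2

/-- A kernel of the size of `‖y‖⁻²` that changes sign under a quarter turn. -/
structure IsTurnKernel (K : ℂ → ℂ) (C : ℝ) : Prop where
  measurable : Measurable K
  norm_le : ∀ y, ‖K y‖ ≤ C / ‖y‖ ^ 2
  I_mul : ∀ y, K (Complex.I * y) = -K y

namespace IsTurnKernel

variable {K : ℂ → ℂ} {C : ℝ}

lemma norm_mul_turnDiff_le (hK : IsTurnKernel K C) (f : ℂ → ℂ) (z y : ℂ) :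
    ‖K y * turnDiff f z y‖ ≤ C * (‖turnDiff f z y‖ / ‖y‖ ^ 2) := by
  rw [norm_mul]
  refine (mul_le_mul_of_nonneg_right (hK.norm_le y) (norm_nonneg _)).trans_eq ?_
  ring

lemma integrable_mul_turnDiff (hK : IsTurnKernel K C) (f : 𝓢(ℂ, ℂ)) (z : ℂ) :
    Integrable (fun y => K y * turnDiff f z y) :=
  ((integrable_turnDiff_div f z).const_mul C).mono'
    (hK.measurable.mul (continuous_turnDiff f.continuous z).measurable).aestronglyMeasurable
    (Eventually.of_forall (hK.norm_mul_turnDiff_le f z))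

lemma integrableOn_mul (hK : IsTurnKernel K C) {g : ℂ → ℂ} (hg : Integrable g) {ε : ℝ}
    (hε : 0 < ε) : IntegrableOn (fun y => K y * g y) {y : ℂ | ε < ‖y‖} := by
  -- The size bound at $y=1$ gives the sign of $C$.
  have hC : 0 ≤ C := by simpa using (norm_nonneg _).trans (hK.norm_le 1)
  have hms : MeasurableSet {y : ℂ | ε < ‖y‖} := measurableSet_lt measurable_const measurable_norm
  refine hg.integrableOn.bdd_mul (c := C / ε ^ 2) hK.measurable.aestronglyMeasurable ?_
  refine (ae_restrict_mem hms).mono fun y hy => (hK.norm_le y).trans ?_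
  have hy' : ε < ‖y‖ := hy
  gcongr

/-- The exterior of a disc is invariant under $y\mapsto iy$, and $K$ changes sign, so the integral
equals minus the one with $f(z-iy)$; half the sum of the two expressions is taken. -/
lemma setIntegral_mul_eq (hK : IsTurnKernel K C) {f : ℂ → ℂ} (hf : Integrable f) (z : ℂ) {ε : ℝ}
    (hε : 0 < ε) : ∫ y in {y : ℂ | ε < ‖y‖}, K y * f (z - y) =
      1 / 2 * ∫ y in {y : ℂ | ε < ‖y‖}, K y * turnDiff f z y := by
  have h1 := measurePreserving_I_mul.setIntegral_preimage_emb measurableEmbedding_I_mul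
    (fun y => K y * f (z - y)) {y : ℂ | ε < ‖y‖}
  simp only [preimage_ofPred_eq, norm_mul, Complex.norm_I, one_mul, hK.I_mul, neg_mul] at h1
  rw [integral_neg] at h1
  simp only [turnDiff, mul_sub]
  rw [integral_sub (hK.integrableOn_mul (hf.comp_sub_left z) hε)
    (hK.integrableOn_mul (integrable_comp_sub_I_mul hf z) hε)]
  linear_combination -1 / 2 * h1

/-- After antisymmetrisation the integrand is absolutely integrable, so the truncation is removed by
dominated convergence. -/
lemma tendsto_truncIntegral (hK : IsTurnKernel K C) (f : 𝓢(ℂ, ℂ)) (z : ℂ) :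
    Tendsto (truncIntegral (fun y => K y * f (z - y)) 0) (𝓝[>] 0)
      (𝓝 (1 / 2 * ∫ y, K y * turnDiff f z y)) := by
  have h : Tendsto (fun ε : ℝ => ∫ y, {y : ℂ | ε < ‖y‖}.indicator
      (fun y => K y * turnDiff f z y) y) (𝓝[>] 0) (𝓝 (∫ y, K y * turnDiff f z y)) := by
    refine tendsto_integral_filter_of_dominated_convergence
      (fun y => ‖K y * turnDiff f z y‖) ?_ ?_ (hK.integrable_mul_turnDiff f z).norm ?_
    · exact Eventually.of_forall fun ε => (hK.integrable_mul_turnDiff f z).1.indicator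
        (measurableSet_lt measurable_const measurable_norm)
    · exact Eventually.of_forall fun ε => Eventually.of_forall fun y =>
        norm_indicator_le_norm_self _ _
    · filter_upwards [Measure.ae_ne volume (0 : ℂ)] with y hy
      refine tendsto_const_nhds.congr' ?_
      filter_upwards [Ioo_mem_nhdsGT (norm_pos_iff.2 hy)] with ε hε
      rw [indicator_of_mem (show y ∈ {y : ℂ | ε < ‖y‖} from hε.2)]
  refine (h.const_mul (1 / 2)).congr' ?_
  filter_upwards [self_mem_nhdsWithin] with ε hε
  rw [integral_indicator (measurableSet_lt measurable_const measurable_norm), truncIntegral]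
  simp only [sub_zero]
  exact (hK.setIntegral_mul_eq f.integrable z hε).symm

lemma pvExists (hK : IsTurnKernel K C) (f : 𝓢(ℂ, ℂ)) (z : ℂ) :
    PVExists (fun y => K y * f (z - y)) 0 := by
  refine ⟨fun ε hε => ?_, _, hK.tendsto_truncIntegral f z⟩
  simp only [sub_zero]
  exact hK.integrableOn_mul (f.integrable.comp_sub_left z) hε

lemma pv_eq (hK : IsTurnKernel K C) (f : 𝓢(ℂ, ℂ)) (z : ℂ) :
    pv (fun y => K y * f (z - y)) 0 = 1 / 2 * ∫ y, K y * turnDiff f z y :=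
  (hK.tendsto_truncIntegral f z).limUnder_eq

end IsTurnKernel

lemma isTurnKernel_kerLattice {r : ℝ} (hr : 0 < r) : IsTurnKernel (kerLattice r) 6 where
  measurable := by
    have h := measurable_kerLattice.comp (measurable_const (a := r) |>.prodMk measurable_id)
    simpa only [Function.comp_def, id_eq] using h
  norm_le := norm_kerLattice_le hr
  I_mul := kerLattice_I_mul r

lemma isTurnKernel_inv_sq : IsTurnKernel (fun y => 1 / y ^ 2) 1 where
  measurable := by fun_prop
  norm_le y := by rw [norm_div, norm_pow, norm_one]
  I_mul y := by rw [mul_pow, Complex.I_sq, neg_one_mul, div_neg]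

lemma latticeAverage_eq {r : ℝ} (hr : 0 < r) (f : 𝓢(ℂ, ℂ)) (z : ℂ) :
    latticeAverage r f z = 1 / 2 * ∫ y, kerLattice r y * turnDiff f z y :=
  (isTurnKernel_kerLattice hr).pv_eq f z

lemma measurePreserving_sub_left (z : ℂ) : MeasurePreserving (fun y : ℂ => z - y) :=
  Measure.measurePreserving_sub_left volume z

lemma measurableEmbedding_sub_left (z : ℂ) : MeasurableEmbedding (fun y : ℂ => z - y) :=
  (Homeomorph.subLeft z).measurableEmbedding

lemma preimage_sub_left_compl_ball (z : ℂ) (ε : ℝ) :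
    (fun y : ℂ => z - y) ⁻¹' {ζ : ℂ | ε < ‖ζ - z‖} = {y : ℂ | ε < ‖y - 0‖} := by
  ext y
  simp only [mem_preimage, mem_ofPred_eq, sub_zero, sub_sub_cancel_left, norm_neg]

/-- The substitution $\zeta=z-y$ brings $T$ to convolution form; the sign disappears in the square.
-/
lemma truncIntegral_beurling (f : ℂ → ℂ) (z : ℂ) :
    truncIntegral (fun ζ => f ζ / (ζ - z) ^ 2) z =
      truncIntegral (fun y => 1 / y ^ 2 * f (z - y)) 0 := by
  funext ε
  rw [truncIntegral, truncIntegral, ← preimage_sub_left_compl_ball z,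
    ← (measurePreserving_sub_left z).setIntegral_preimage_emb (measurableEmbedding_sub_left z)]
  refine setIntegral_congr_fun ?_ fun y _ => ?_
  · exact measurableSet_preimage (measurable_const.sub measurable_id)
      (measurableSet_lt measurable_const (measurable_id.sub_const z).norm)
  · simp only [sub_sub_cancel_left, neg_sq]
    ring

lemma pvExists_beurling (f : 𝓢(ℂ, ℂ)) (z : ℂ) : PVExists (fun ζ => f ζ / (ζ - z) ^ 2) z := by
  refine ⟨fun ε hε => ?_, ?_⟩
  · rw [← (measurePreserving_sub_left z).integrableOn_comp_preimage
      (measurableEmbedding_sub_left z), preimage_sub_left_compl_ball]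
    refine ((isTurnKernel_inv_sq.pvExists f z).1 ε hε).congr_fun (fun y _ => ?_) ?_
    · simp only [Function.comp_apply, sub_sub_cancel_left, neg_sq]
      ring
    · simp only [sub_zero]
      exact measurableSet_lt measurable_const measurable_norm
  · rw [truncIntegral_beurling]
    exact (isTurnKernel_inv_sq.pvExists f z).2

lemma ahlforsBeurling_eq (f : 𝓢(ℂ, ℂ)) (z : ℂ) : ahlforsBeurling f z =
    -(1 / (Real.pi : ℂ)) * (1 / 2 * ∫ y, 1 / y ^ 2 * turnDiff f z y) := by
  rw [ahlforsBeurling, pv, truncIntegral_beurling, ← isTurnKernel_inv_sq.pv_eq f z, pv]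

/-! ### The translation average as a convolution -/

lemma haarSquare_eq_sub (a : ℂ) (l : ℝ) (z : ℂ) : haarSquare a l z = haarSquare 0 l (z - a) := by
  have h : ∀ a b c x : ℝ, chi (Ico (a + b) (a + c)) x = chi (Ico b c) (x - a) := fun a b c x => by
    refine chi_congr ?_
    simp only [mem_Ico]
    constructor <;> rintro ⟨h1, h2⟩ <;> constructor <;> linarith
  have h' : ∀ a c x : ℝ, chi (Ico a (a + c)) x = chi (Ico 0 c) (x - a) := fun a c x => by
    simpa using h a 0 c x
  simp only [haarSquare, haarInterval, h, h', Complex.zero_re, Complex.zero_im, sub_zero,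
    Complex.sub_re, Complex.sub_im]

lemma measurable_haarSquare (a : ℂ) (l : ℝ) : Measurable (haarSquare a l) := by
  unfold haarSquare haarInterval
  have h : ∀ a b : ℝ, Measurable (chi (Ico a b)) := fun a b => measurable_chi measurableSet_Ico
  have h1 := h a.re (a.re + l)
  have h2 := h (a.im + l / 2) (a.im + l)
  have h3 := h a.im (a.im + l / 2)
  fun_prop

lemma haarSquare_of_notMem {l : ℝ} (hl : 0 < l) {z : ℂ} (hz : z ∉ refPoints l) :
    haarSquare 0 l z = 0 := by
  rw [refPoints, Complex.mem_reProdIm, not_and_or] at hz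
  rw [haarSquare, haarInterval]
  simp only [Complex.zero_re, Complex.zero_im, zero_add]
  rcases hz with hz | hz
  · rw [chi_notMem hz]; simp
  · have h1 : z.im ∉ Ico (l / 2) l := fun h => hz ⟨by linarith [h.1], h.2⟩
    have h2 : z.im ∉ Ico 0 (l / 2) := fun h => hz ⟨h.1, by linarith [h.2]⟩
    rw [chi_notMem h1, chi_notMem h2]; simp

lemma abs_haarSquare_le {l : ℝ} (hl : 0 < l) (a z : ℂ) : |haarSquare a l z| ≤ 1 / l := by
  rw [haarSquare, haarInterval, mul_mul_mul_comm, ← mul_assoc, div_mul_div_comm, one_mul,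
    Real.mul_self_sqrt hl.le, mul_assoc, abs_mul, abs_of_pos (by positivity : 0 < 1 / l)]
  refine mul_le_of_le_one_right (by positivity) ?_
  rw [abs_mul]
  refine mul_le_one₀ ?_ (abs_nonneg _) ?_
  · rw [abs_of_nonneg (chi_nonneg _ _)]; exact chi_le_one _ _
  · have h1 := chi_nonneg (Ico (a.im + l / 2) (a.im + l)) z.im
    have h2 := chi_nonneg (Ico a.im (a.im + l / 2)) z.im
    have h3 := chi_le_one (Ico (a.im + l / 2) (a.im + l)) z.im
    have h4 := chi_le_one (Ico a.im (a.im + l / 2)) z.im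
    rw [abs_le]
    constructor <;> linarith

lemma measurableSet_refPoints (ρ : ℝ) : MeasurableSet (refPoints ρ) :=
  (Complex.measurable_re measurableSet_Ico).inter (Complex.measurable_im measurableSet_Ico)

lemma volume_refPoints_lt_top (ρ : ℝ) : volume (refPoints ρ) < ⊤ :=
  ((Metric.isBounded_Ico 0 ρ).reProdIm (Metric.isBounded_Ico 0 ρ)).measure_lt_top

lemma integrable_haarSquare {l : ℝ} (hl : 0 < l) :
    Integrable (fun z => (haarSquare 0 l z : ℂ)) := by
  have h : IntegrableOn (fun z => (haarSquare 0 l z : ℂ)) (refPoints l) := by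
    refine Measure.integrableOn_of_bounded (M := 1 / l) (volume_refPoints_lt_top l).ne
      (measurable_haarSquare 0 l).complex_ofReal.aestronglyMeasurable
      (Eventually.of_forall fun z => ?_)
    rw [Complex.norm_real]
    exact abs_haarSquare_le hl 0 z
  exact h.integrable_of_forall_notMem_eq_zero fun z hz => by
    rw [haarSquare_of_notMem hl hz, Complex.ofReal_zero]

/-- The contribution to the projection at `z` of the square with lower left vertex `s`. -/
def squareTerm (ρ : ℝ) (f : ℂ → ℂ) (z s : ℂ) : ℂ :=
  (∫ w : ℂ, f w * (haarSquare s ρ w : ℂ)) * (haarSquare s ρ z : ℂ)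

lemma squareTerm_of_notMem {ρ : ℝ} (hρ : 0 < ρ) (f : ℂ → ℂ) {z s : ℂ}
    (h : z - s ∉ refPoints ρ) : squareTerm ρ f z s = 0 := by
  rw [squareTerm, haarSquare_eq_sub s ρ z, haarSquare_of_notMem hρ h, Complex.ofReal_zero, mul_zero]

lemma norm_squareTerm_le {ρ : ℝ} (hρ : 0 < ρ) {f : ℂ → ℂ} (hf : Integrable f) (z s : ℂ) :
    ‖squareTerm ρ f z s‖ ≤ (∫ w, ‖f w‖ * (1 / ρ)) * (1 / ρ) := by
  rw [squareTerm, norm_mul, Complex.norm_real, Real.norm_eq_abs]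
  refine mul_le_mul ?_ (abs_haarSquare_le hρ _ _) (abs_nonneg _)
    (integral_nonneg fun w => by positivity)
  refine norm_integral_le_of_norm_le (hf.norm.mul_const _) (Eventually.of_forall fun w => ?_)
  rw [norm_mul, Complex.norm_real]
  exact mul_le_mul_of_nonneg_left (abs_haarSquare_le hρ _ _) (norm_nonneg _)

/-- One Haar factor, integrable in the vertex, times $f$ is integrable on the product, and the other
Haar factor is bounded by $1/\rho$. This licenses Fubini. -/
lemma integrable_prod_squareTerm {ρ : ℝ} (hρ : 0 < ρ) {f : ℂ → ℂ} (hf : Integrable f) (z : ℂ) :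
    Integrable (fun p : ℂ × ℂ =>
      f p.2 * (haarSquare p.1 ρ p.2 : ℂ) * (haarSquare p.1 ρ z : ℂ)) := by
  have h1 : Integrable (fun p : ℂ × ℂ => (haarSquare 0 ρ (z - p.1) : ℂ) * f p.2) :=
    ((integrable_haarSquare hρ).comp_sub_left z).mul_prod hf
  have h2 : Measurable (fun p : ℂ × ℂ => (haarSquare 0 ρ (p.2 - p.1) : ℂ)) :=
    ((measurable_haarSquare 0 ρ).comp (measurable_snd.sub measurable_fst)).complex_ofReal
  refine (h1.bdd_mul (c := 1 / ρ) h2.aestronglyMeasurable (Eventually.of_forall fun p => ?_)).congr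
    (Eventually.of_forall fun p => ?_)
  · rw [Complex.norm_real]
    exact abs_haarSquare_le hρ _ _
  · simp only [haarSquare_eq_sub p.1 ρ]
    ring

lemma integrable_squareTerm {ρ : ℝ} (hρ : 0 < ρ) {f : ℂ → ℂ} (hf : Integrable f) (z : ℂ) :
    Integrable (squareTerm ρ f z) := by
  have h := (integrable_prod_squareTerm hρ hf z).integral_prod_left
  simp only [integral_mul_const] at h
  exact h

lemma integral_squareTerm {ρ : ℝ} (hρ : 0 < ρ) {f : ℂ → ℂ} (hf : Integrable f) (z : ℂ) :
    ∫ s, squareTerm ρ f z s = ∫ w, f w * (kerF ((z - w) / (ρ : ℂ)) : ℂ) := by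
  have h := integral_integral_swap (μ := volume) (ν := volume)
    (f := fun s w : ℂ => f w * (haarSquare s ρ w : ℂ) * (haarSquare s ρ z : ℂ))
    (integrable_prod_squareTerm hρ hf z)
  simp only [squareTerm, ← integral_mul_const]
  rw [h]
  refine integral_congr_ae (Eventually.of_forall fun w => ?_)
  simp only [mul_assoc]
  rw [integral_const_mul, ← integral_haarSquare_mul hρ, ← integral_complex_ofReal]
  simp only [Complex.ofReal_mul]

/-- The squares of a grid cover every point exactly once. -/
lemma sub_corner_mem_refPoints_iff {ρ : ℝ} (hρ : 0 < ρ) (z t : ℂ) (m : ℤ × ℤ) :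
    z - corner ρ t m ∈ refPoints ρ ↔
      m = (⌊(z.re - t.re) / ρ⌋, ⌊(z.im - t.im) / ρ⌋) := by
  have h : ∀ (x : ℝ) (n : ℤ), x - ρ * n ∈ Ico 0 ρ ↔ n = ⌊x / ρ⌋ := fun x n => by
    rw [eq_comm, Int.floor_eq_iff, le_div_iff₀ hρ, div_lt_iff₀ hρ, mem_Ico]
    constructor <;> rintro ⟨h1, h2⟩ <;> constructor <;> linarith
  have hre : (z - corner ρ t m).re = z.re - t.re - ρ * m.1 := by simp [corner]; ring
  have him : (z - corner ρ t m).im = z.im - t.im - ρ * m.2 := by simp [corner]; ring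
  rw [refPoints, Complex.mem_reProdIm, hre, him, h, h, Prod.ext_iff]

lemma gridProjection_eq {ρ : ℝ} (hρ : 0 < ρ) (t : ℂ) (f : ℂ → ℂ) (z : ℂ) :
    gridProjection ρ t f z =
      squareTerm ρ f z (corner ρ t (⌊(z.re - t.re) / ρ⌋, ⌊(z.im - t.im) / ρ⌋)) :=
  tsum_eq_single _ fun m hm =>
    squareTerm_of_notMem hρ f ((sub_corner_mem_refPoints_iff hρ z t m).not.2 hm)

/-- The cells obtained by moving `refPoints ρ` to the lattice points tile the plane, so an integral
over the plane unfolds into a sum over the grid indices. -/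
lemma hasSum_integral_corner {ρ : ℝ} (hρ : 0 < ρ) {E : Type*} [NormedAddCommGroup E]
    [NormedSpace ℝ E] {g : ℂ → E} (hg : Integrable g) :
    HasSum (fun m => ∫ t in refPoints ρ, g (corner ρ t m)) (∫ s, g s) := by
  have hcell : ∀ m : ℤ × ℤ, (fun t => corner ρ t m) ⁻¹'
      {s | s - corner ρ 0 m ∈ refPoints ρ} = refPoints ρ := fun m => by
    ext t
    have : corner ρ t m - corner ρ 0 m = t := by simp [corner]
    simp only [mem_preimage, mem_ofPred_eq, this]
  have hpres : ∀ m, MeasurePreserving (fun t => corner ρ t m) := fun m =>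
    measurePreserving_add_right volume _
  have hemb : ∀ m, MeasurableEmbedding (fun t => corner ρ t m) := fun m =>
    measurableEmbedding_addRight _
  have hunion : ⋃ m, {s | s - corner ρ 0 m ∈ refPoints ρ} = univ := by
    refine eq_univ_of_forall fun s =>
      mem_iUnion.2 ⟨(⌊(s.re - (0 : ℂ).re) / ρ⌋, ⌊(s.im - (0 : ℂ).im) / ρ⌋), ?_⟩
    exact (sub_corner_mem_refPoints_iff hρ s 0 _).2 rfl
  have key := hasSum_integral_iUnion (μ := volume) (f := g)
    (s := fun m => {s | s - corner ρ 0 m ∈ refPoints ρ})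
    (fun m => (measurable_id.sub_const _) (measurableSet_refPoints ρ))
    (fun m n hmn => Set.disjoint_left.2 fun s hm hn => hmn ?_) (by rwa [hunion, integrableOn_univ])
  · rw [hunion, setIntegral_univ] at key
    refine key.congr_fun fun m => ?_
    rw [← (hpres m).setIntegral_preimage_emb (hemb m) g, hcell]
  · rw [(sub_corner_mem_refPoints_iff hρ s 0 m).1 hm, (sub_corner_mem_refPoints_iff hρ s 0 n).1 hn]

lemma measurable_squareTerm (ρ : ℝ) {f : ℂ → ℂ} (hf : Measurable f) (z : ℂ) :
    Measurable (squareTerm ρ f z) := by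
  have h1 : Measurable (fun p : ℂ × ℂ => f p.2 * (haarSquare p.1 ρ p.2 : ℂ)) := by
    simp only [fun p : ℂ × ℂ => haarSquare_eq_sub p.1 ρ p.2]
    exact (hf.comp measurable_snd).mul
      ((measurable_haarSquare 0 ρ).comp (measurable_snd.sub measurable_fst)).complex_ofReal
  have h2 : Measurable (fun s : ℂ => (haarSquare s ρ z : ℂ)) := by
    simp only [fun s : ℂ => haarSquare_eq_sub s ρ z]
    exact ((measurable_haarSquare 0 ρ).comp (measurable_id.const_sub z)).complex_ofReal
  exact h1.stronglyMeasurable.integral_prod_right'.measurable.mul h2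

lemma integrableOn_gridProjection {ρ : ℝ} (hρ : 0 < ρ) {f : ℂ → ℂ} (hfm : Measurable f)
    (hf : Integrable f) (z : ℂ) :
    IntegrableOn (fun t => gridProjection ρ t f z) (refPoints ρ) := by
  have hmeas : Measurable (fun t => gridProjection ρ t f z) :=
    Measurable.tsum fun m => (measurable_squareTerm ρ hfm z).comp (measurable_id.add_const _)
  refine Measure.integrableOn_of_bounded (M := (∫ w, ‖f w‖ * (1 / ρ)) * (1 / ρ))
    (volume_refPoints_lt_top ρ).ne hmeas.aestronglyMeasurable
    (Eventually.of_forall fun t => ?_)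
  rw [gridProjection_eq hρ]
  exact norm_squareTerm_le hρ hf z _

/-- Sum and integral are interchanged and the tiling folds them into one integral over all vertices;
Fubini then leaves the autocorrelation of a Haar square. -/
lemma translationAverage_eq {ρ : ℝ} (hρ : 0 < ρ) {f : ℂ → ℂ} (hf : Integrable f) (z : ℂ) :
    translationAverage ρ f z = ∫ w, f w * kerFScaled ρ (z - w) := by
  have hint := integrable_squareTerm hρ hf z
  have h : ∫ t in refPoints ρ, gridProjection ρ t f z = ∫ s, squareTerm ρ f z s := by
    refine HasSum.unique (hasSum_integral_of_summable_integral_norm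
      (F := fun m t => squareTerm ρ f z (corner ρ t m)) (fun m => ?_) ?_)
      (hasSum_integral_corner hρ hint)
    · exact ((measurePreserving_add_right volume _).integrable_comp_emb
        (measurableEmbedding_addRight _)).2 hint |>.integrableOn
    · exact (hasSum_integral_corner hρ hint.norm).summable
  rw [translationAverage, h, integral_squareTerm hρ hf, ← integral_const_mul]
  refine integral_congr_ae (Eventually.of_forall fun w => ?_)
  simp only [kerFScaled]
  push_cast
  ring

/-! ### Rotation averages and their sum over dyadic scales -/

lemma continuous_rot {f : ℂ → ℂ} (hf : Continuous f) (ψ : ℝ) : Continuous (rot ψ f) := by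
  unfold rot; fun_prop

lemma measurePreserving_exp_mul (ψ : ℝ) :
    MeasurePreserving (fun z : ℂ => Complex.exp (-(ψ : ℂ) * Complex.I) * z) := by
  have h := (rotation (Circle.exp (-ψ))).measurePreserving
  convert h using 1
  funext z
  rw [rotation_apply, Circle.coe_exp, Complex.ofReal_neg]

lemma measurableEmbedding_exp_mul (ψ : ℝ) :
    MeasurableEmbedding (fun z : ℂ => Complex.exp (-(ψ : ℂ) * Complex.I) * z) :=
  (Homeomorph.mulLeft₀ _ (Complex.exp_ne_zero _)).measurableEmbedding

lemma integrable_rot {f : ℂ → ℂ} (hf : Integrable f) (ψ : ℝ) : Integrable (rot ψ f) :=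
  ((measurePreserving_exp_mul ψ).integrable_comp_emb (measurableEmbedding_exp_mul ψ)).2 hf

/-- Conjugating the translation average by a rotation rotates its kernel. -/
lemma rot_translationAverage_eq {ρ : ℝ} (hρ : 0 < ρ) {f : ℂ → ℂ} (hf : Integrable f) (z : ℂ)
    (ψ : ℝ) : rot ψ (translationAverage ρ (rot (-ψ) f)) z =
      ∫ y, f (z - y) * rot ψ (kerFScaled ρ) y := by
  have hexp : Complex.exp (-((-ψ : ℝ) : ℂ) * Complex.I) *
      Complex.exp (-(ψ : ℂ) * Complex.I) = 1 := by
    rw [← Complex.exp_add, ← Complex.exp_zero]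
    push_cast; ring_nf
  rw [rot, translationAverage_eq hρ (integrable_rot hf _),
    ← (measurePreserving_exp_mul ψ).integral_comp (measurableEmbedding_exp_mul ψ),
    ← integral_sub_left_eq_self _ volume z]
  refine integral_congr_ae (Eventually.of_forall fun y => ?_)
  simp only [rot]
  rw [← mul_assoc (Complex.exp (-((-ψ : ℝ) : ℂ) * Complex.I)), hexp, one_mul, ← mul_sub,
    sub_sub_cancel]

lemma integrable_prod_rot {ρ : ℝ} (hρ : 0 < ρ) {f : ℂ → ℂ} (hf : Integrable f) (z : ℂ) :
    Integrable (fun p : ℝ × ℂ =>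
        f (z - p.2) * (rot p.1 (kerFScaled ρ) p.2 * rotWeight p.1))
      ((volume.restrict (Ioc 0 (2 * Real.pi))).prod volume) := by
  have h1 : Integrable (fun p : ℝ × ℂ => (1 : ℂ) * f (z - p.2))
      ((volume.restrict (Ioc 0 (2 * Real.pi))).prod volume) :=
    Integrable.mul_prod (f := fun _ : ℝ => (1 : ℂ)) (integrable_const _) (hf.comp_sub_left z)
  have h2 : Measurable (fun p : ℝ × ℂ => rot p.1 (kerFScaled ρ) p.2 * rotWeight p.1) := by
    have h := measurable_rot_kerFScaled.comp
      ((measurable_const (a := ρ)).prodMk measurable_snd |>.prodMk measurable_fst :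
        Measurable (fun p : ℝ × ℂ => ((ρ, p.2), p.1)))
    simpa only [Function.comp_def] using h
  refine (h1.mul_bdd (c := 1 / ρ ^ 2) h2.aestronglyMeasurable
    (Eventually.of_forall fun p => ?_)).congr (Eventually.of_forall fun p => ?_)
  · refine (norm_rot_kerFScaled_le hρ _ _).trans ?_
    unfold envelope
    split_ifs
    exacts [le_rfl, by positivity]
  · simp only [one_mul]

lemma intervalIntegrable_rot_translationAverage {ρ : ℝ} (hρ : 0 < ρ) {f : ℂ → ℂ}
    (hf : Integrable f) (z : ℂ) :
    IntervalIntegrable (fun ψ : ℝ => rot ψ (translationAverage ρ (rot (-ψ) f)) z * rotWeight ψ)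
      volume 0 (2 * Real.pi) := by
  rw [intervalIntegrable_iff_integrableOn_Ioc_of_le Real.two_pi_pos.le]
  have h := (integrable_prod_rot hρ hf z).integral_prod_left
  simp only [← mul_assoc, integral_mul_const] at h
  simp only [rot_translationAverage_eq hρ hf]
  exact h

lemma rotationAverage_eq_convolution {ρ : ℝ} (hρ : 0 < ρ) {f : ℂ → ℂ} (hf : Integrable f) (z : ℂ) :
    rotationAverage ρ f z = ∫ y, kerG ρ y * f (z - y) := by
  have h := integral_integral_swap
    (f := fun (ψ : ℝ) (y : ℂ) => f (z - y) * (rot ψ (kerFScaled ρ) y * rotWeight ψ))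
    (integrable_prod_rot hρ hf z)
  simp only [rotationAverage, rot_translationAverage_eq hρ hf, kerG,
    intervalIntegral.integral_of_le Real.two_pi_pos.le]
  simp only [integral_const_mul] at h
  simp only [← mul_assoc, integral_mul_const] at h
  rw [h, ← integral_const_mul]
  refine integral_congr_ae (Eventually.of_forall fun y => ?_)
  ring

lemma measurable_kerG_right (ρ : ℝ) : Measurable (kerG ρ) := by
  have h := measurable_kerG_comp (measurable_const (a := ρ)) (measurable_id (α := ℂ))
  simpa only [id_eq] using h

/-- The antisymmetrisation used for principal values, here without truncation since the kernel of a
single scale is bounded. -/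
lemma rotationAverage_eq {ρ : ℝ} (hρ : 0 < ρ) {f : ℂ → ℂ} (hf : Integrable f) (z : ℂ) :
    rotationAverage ρ f z = 1 / 2 * ∫ y, kerG ρ y * turnDiff f z y := by
  have hint : ∀ {g : ℂ → ℂ}, Integrable g → Integrable (fun y => kerG ρ y * g y) := fun hg => by
    refine hg.bdd_mul (c := 1 / ρ ^ 2) (measurable_kerG_right ρ).aestronglyMeasurable
      (Eventually.of_forall fun y => (norm_kerG_le hρ y).trans ?_)
    unfold envelope
    split_ifs
    exacts [le_rfl, by positivity]
  have h1 := measurePreserving_I_mul.integral_comp measurableEmbedding_I_mul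
    (fun y => kerG ρ y * f (z - y))
  simp only [kerG_I_mul, neg_mul] at h1
  rw [integral_neg] at h1
  simp only [turnDiff, mul_sub]
  rw [integral_sub (hint (hf.comp_sub_left z)) (hint (integrable_comp_sub_I_mul hf z)),
    rotationAverage_eq_convolution hρ hf]
  linear_combination -1 / 2 * h1

lemma summable_norm_kerG_mul {r : ℝ} (hr : 0 < r) (y a : ℂ) :
    Summable (fun n : ℤ => ‖kerG ((2 : ℝ) ^ n * r) y * a‖) ∧
      ∑' n : ℤ, ‖kerG ((2 : ℝ) ^ n * r) y * a‖ ≤ 6 * (‖a‖ / ‖y‖ ^ 2) := by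
  simp only [norm_mul]
  obtain ⟨h1, h2⟩ := summable_norm_kerG hr y
  refine ⟨h1.mul_right _, ?_⟩
  rw [tsum_mul_right]
  refine (mul_le_mul_of_nonneg_right h2 (norm_nonneg a)).trans_eq ?_
  ring

/-- In antisymmetrised form the sum of the absolute values is at most $6|f(z-y)-f(z-iy)|/|y|^2$, an
integrable majorant independent of $r$. -/
lemma hasSum_rotationAverage (f : 𝓢(ℂ, ℂ)) (z : ℂ) {r : ℝ} (hr : 0 < r) :
    HasSum (fun n : ℤ => rotationAverage ((2 : ℝ) ^ n * r) f z) (latticeAverage r f z) := by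
  have hm : ∀ n : ℤ, Measurable (fun y => kerG ((2 : ℝ) ^ n * r) y * turnDiff f z y) := fun n =>
    (measurable_kerG_right _).mul (continuous_turnDiff f.continuous z).measurable
  rw [latticeAverage_eq hr]
  simp only [fun n : ℤ => rotationAverage_eq (show 0 < (2 : ℝ) ^ n * r by positivity)
    f.integrable z]
  refine HasSum.mul_left _ (hasSum_integral_of_dominated_convergence
    (fun n y => ‖kerG ((2 : ℝ) ^ n * r) y * turnDiff f z y‖)
    (fun n => (hm n).aestronglyMeasurable) (fun n => Eventually.of_forall fun y => le_rfl)
    (Eventually.of_forall fun y => (summable_norm_kerG_mul hr y _).1) ?_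
    (Eventually.of_forall fun y => ?_))
  · refine ((integrable_turnDiff_div f z).const_mul 6).mono'
      (Measurable.tsum fun n => (hm n).norm).aestronglyMeasurable (Eventually.of_forall fun y => ?_)
    rw [Real.norm_of_nonneg (tsum_nonneg fun n => norm_nonneg _)]
    exact (summable_norm_kerG_mul hr y _).2
  · exact (summable_kerG hr y).hasSum.mul_right _

/-! ### Averaging over calibres: the kernel becomes a multiple of $1/y^2$ -/

/-- The second angular Fourier coefficient (up to `2π`) of the kernel `F` on the circle of
radius `u`. -/
def kerCoeff (u : ℝ) : ℂ :=
  ∫ φ in (-Real.pi)..Real.pi,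
    (kerF ((u : ℂ) * Complex.exp ((φ : ℂ) * Complex.I)) : ℂ) * Complex.exp (2 * (φ : ℂ) * Complex.I)

/-- The substitution $\psi=\arg y-\varphi$ splits off the phase $e^{-2i\arg y}$; what remains
depends only on $|y|/\rho$. -/
lemma kerG_eq_kerCoeff (ρ : ℝ) (y : ℂ) : kerG ρ y =
    ((1 / (2 * Real.pi) : ℝ) : ℂ) * (Complex.exp (-2 * (y.arg : ℂ) * Complex.I) *
      (((1 / ρ ^ 2 : ℝ) : ℂ) * kerCoeff (‖y‖ / ρ))) := by
  have h : ∀ φ : ℝ, rot (y.arg - φ) (kerFScaled ρ) y * rotWeight (y.arg - φ) =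
      Complex.exp (-2 * (y.arg : ℂ) * Complex.I) * (((1 / ρ ^ 2 : ℝ) : ℂ) *
        ((kerF (((‖y‖ / ρ : ℝ) : ℂ) * Complex.exp ((φ : ℂ) * Complex.I)) : ℂ) *
          Complex.exp (2 * (φ : ℂ) * Complex.I))) := fun φ => by
    have h1 : Complex.exp (-((y.arg - φ : ℝ) : ℂ) * Complex.I) * y =
        (‖y‖ : ℂ) * Complex.exp ((φ : ℂ) * Complex.I) := by
      conv_lhs => rw [← Complex.norm_mul_exp_arg_mul_I y]
      rw [mul_left_comm, ← Complex.exp_add, Complex.norm_mul_exp_arg_mul_I]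
      push_cast; ring_nf
    have h2 : rotWeight (y.arg - φ) = Complex.exp (-2 * (y.arg : ℂ) * Complex.I) *
        Complex.exp (2 * (φ : ℂ) * Complex.I) := by
      rw [rotWeight, ← Complex.exp_add]
      push_cast; ring_nf
    rw [rot, h1, h2, kerFScaled, mul_div_right_comm, ← Complex.ofReal_div, Complex.ofReal_mul]
    ring
  have e := (rot_mul_rotWeight_periodic (kerFScaled ρ) y).intervalIntegral_add_eq
    (y.arg - Real.pi) 0
  rw [show y.arg - Real.pi + 2 * Real.pi = y.arg - -Real.pi by ring, zero_add,
    ← intervalIntegral.integral_comp_sub_left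
      (fun ψ => rot ψ (kerFScaled ρ) y * rotWeight ψ)] at e
  rw [kerG, ← e]
  simp only [h]
  rw [intervalIntegral.integral_const_mul, intervalIntegral.integral_const_mul, kerCoeff]

/-- The angular mean of `F` against the square of the phase, which is `2π` times the factor of
`1 / y²` in the average of the kernels over all scales. -/
def phaseMean : ℂ := ∫ w : ℂ, (kerF w : ℂ) * (w / ‖w‖) ^ 2

lemma integrableOn_polar_kerF :
    IntegrableOn (fun p : ℝ × ℝ => (p.1 : ℂ) *
      ((kerF ((p.1 : ℂ) * Complex.exp ((p.2 : ℂ) * Complex.I)) : ℂ) *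
        Complex.exp (2 * (p.2 : ℂ) * Complex.I)))
      (Ioi 0 ×ˢ Ioo (-Real.pi) Real.pi) (volume.prod volume) := by
  have hb : IntegrableOn (fun p : ℝ × ℝ => (Ioc 0 2).indicator (fun _ => (2 : ℝ)) p.1 * 1)
      (Ioi 0 ×ˢ Ioo (-Real.pi) Real.pi) (volume.prod volume) := by
    rw [IntegrableOn, ← Measure.prod_restrict]
    refine Integrable.mul_prod (f := (Ioc (0 : ℝ) 2).indicator (fun _ => (2 : ℝ)))
      (g := fun _ : ℝ => (1 : ℝ)) ?_ (integrable_const _)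
    exact ((integrable_indicator_iff measurableSet_Ioc).2
      (integrableOn_const (by simp))).integrableOn
  have hc : Continuous (fun p : ℝ × ℝ => (p.1 : ℂ) *
      ((kerF ((p.1 : ℂ) * Complex.exp ((p.2 : ℂ) * Complex.I)) : ℂ) *
        Complex.exp (2 * (p.2 : ℂ) * Complex.I))) := by
    have := continuous_kerF
    fun_prop
  refine hb.mono' hc.aestronglyMeasurable ?_
  refine (ae_restrict_mem (measurableSet_Ioi.prod measurableSet_Ioo)).mono fun p hp => ?_
  have hp1 : 0 < p.1 := hp.1
  rw [norm_mul, norm_mul, Complex.norm_real, Complex.norm_real, Real.norm_of_nonneg hp1.le,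
    show (2 * (p.2 : ℂ) * Complex.I) = ((2 * p.2 : ℝ) : ℂ) * Complex.I by push_cast; ring,
    Complex.norm_exp_ofReal_mul_I, mul_one, mul_one, Real.norm_eq_abs]
  by_cases h2 : p.1 ≤ 2
  · rw [indicator_of_mem (show p.1 ∈ Ioc 0 2 from ⟨hp1, h2⟩)]
    have := abs_kerF_le ((p.1 : ℂ) * Complex.exp ((p.2 : ℂ) * Complex.I))
    have := abs_nonneg (kerF ((p.1 : ℂ) * Complex.exp ((p.2 : ℂ) * Complex.I)))
    nlinarith
  · rw [kerF_of_two_le, abs_zero, mul_zero]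
    · exact indicator_nonneg (fun _ _ => zero_le_two) _
    · rw [norm_mul, Complex.norm_exp_ofReal_mul_I, Complex.norm_real, mul_one,
        Real.norm_of_nonneg hp1.le]
      linarith

/-- Polar coordinates: $u$ is the Jacobian and $e^{2i\varphi}=(w/|w|)^2$. -/
lemma integral_kerCoeff : ∫ u in Ioi (0 : ℝ), (u : ℂ) * kerCoeff u = phaseMean := by
  have h := setIntegral_prod _ integrableOn_polar_kerF
  rw [phaseMean, ← Complex.integral_comp_polarCoord_symm]
  refine Eq.trans ?_ (h.symm.trans ?_)
  · refine setIntegral_congr_fun measurableSet_Ioi fun u _ => ?_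
    simp only
    rw [integral_const_mul, kerCoeff, intervalIntegral.integral_of_le (by linarith [Real.pi_pos]),
      integral_Ioc_eq_integral_Ioo]
  · refine setIntegral_congr_fun (measurableSet_Ioi.prod measurableSet_Ioo) fun p hp => ?_
    have hp1 : 0 < p.1 := hp.1
    have hne : (p.1 : ℂ) ≠ 0 := Complex.ofReal_ne_zero.2 hp1.ne'
    simp only [Complex.polarCoord_symm_apply, Complex.real_smul]
    rw [← Complex.exp_ofReal_mul_I, norm_mul, Complex.norm_exp_ofReal_mul_I, Complex.norm_real,
      mul_one, Real.norm_of_nonneg hp1.le, mul_div_cancel_left₀ _ hne, ← Complex.exp_nat_mul]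
    congr 3
    push_cast; ring

lemma integral_kerG_div {y : ℂ} (hy : y ≠ 0) :
    ∫ ρ in Ioi (0 : ℝ), kerG ρ y * ((1 / ρ : ℝ) : ℂ) =
      ((1 / (2 * Real.pi) : ℝ) : ℂ) * phaseMean * (1 / y ^ 2) := by
  have hR : 0 < ‖y‖ := norm_pos_iff.2 hy
  -- The exponent $-1$ encodes $u=1/\rho$, which turns $\rho^{-2}\,d\rho/\rho$ into $u\,du$; the
  -- dilation by $|y|$ in `h2` then produces $|y|^{-2}$.
  have h1 := integral_comp_rpow_Ioi (fun u : ℝ => (u : ℂ) * kerCoeff (‖y‖ * u))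
    (p := -1) (by norm_num)
  have h2 := integral_comp_mul_left_Ioi (fun v : ℝ => (v : ℂ) * kerCoeff v) 0 hR
  rw [mul_zero, integral_kerCoeff] at h2
  have h3 : ∫ u in Ioi (0 : ℝ), (u : ℂ) * kerCoeff (‖y‖ * u) =
      ((1 / ‖y‖ ^ 2 : ℝ) : ℂ) * phaseMean := by
    have hne : (‖y‖ : ℂ) ≠ 0 := Complex.ofReal_ne_zero.2 hR.ne'
    simp only [Complex.ofReal_mul, mul_assoc] at h2
    rw [integral_const_mul, Complex.real_smul] at h2
    apply mul_left_cancel₀ hne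
    rw [h2]
    push_cast
    field_simp
  have h4 : Complex.exp (-2 * (y.arg : ℂ) * Complex.I) * ((1 / ‖y‖ ^ 2 : ℝ) : ℂ) = 1 / y ^ 2 := by
    conv_rhs => rw [← Complex.norm_mul_exp_arg_mul_I y]
    rw [mul_pow, ← Complex.exp_nat_mul, show (-2 * (y.arg : ℂ) * Complex.I) =
      -(((2 : ℕ) : ℂ) * ((y.arg : ℂ) * Complex.I)) by push_cast; ring, Complex.exp_neg]
    push_cast
    rw [one_div, one_div, mul_inv, mul_comm]
  calc ∫ ρ in Ioi (0 : ℝ), kerG ρ y * ((1 / ρ : ℝ) : ℂ)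
      = ∫ ρ in Ioi (0 : ℝ), ((1 / (2 * Real.pi) : ℝ) : ℂ) *
          Complex.exp (-2 * (y.arg : ℂ) * Complex.I) *
          ((|(-1 : ℝ)| * ρ ^ ((-1 : ℝ) - 1)) • (((ρ ^ (-1 : ℝ) : ℝ) : ℂ) *
            kerCoeff (‖y‖ * ρ ^ (-1 : ℝ)))) := by
        refine setIntegral_congr_fun measurableSet_Ioi fun ρ hρ => ?_
        have hρ' : (0 : ℝ) < ρ := hρ
        rw [kerG_eq_kerCoeff, Real.rpow_neg_one, show (-1 : ℝ) - 1 = ((-2 : ℤ) : ℝ) by norm_num,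
          Real.rpow_intCast, abs_neg, abs_one, one_mul, ← div_eq_mul_inv, Complex.real_smul,
          zpow_neg, show (2 : ℤ) = ((2 : ℕ) : ℤ) by rfl, zpow_natCast]
        push_cast
        ring
    _ = _ := by
        rw [integral_const_mul, h1, h3, ← h4]
        ring

lemma integrableOn_kerG_div {y : ℂ} (hy : y ≠ 0) :
    IntegrableOn (fun ρ : ℝ => kerG ρ y * ((1 / ρ : ℝ) : ℂ)) (Ioi 0) := by
  -- The kernel vanishes for $2\rho<|y|$. Cutting at $|y|/3$ keeps this strict at the endpoint;
  -- beyond the cut the integrand is $O(\rho^{-3})$.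
  have hR : 0 < ‖y‖ / 3 := by have := norm_pos_iff.2 hy; positivity
  have hm : Measurable (fun ρ : ℝ => kerG ρ y * ((1 / ρ : ℝ) : ℂ)) :=
    (measurable_kerG_comp measurable_id measurable_const).mul
      (by fun_prop : Measurable (fun ρ : ℝ => ((1 / ρ : ℝ) : ℂ)))
  rw [← Ioc_union_Ioi_eq_Ioi hR.le]
  refine IntegrableOn.union ?_ ?_
  · refine integrableOn_zero.congr_fun (fun ρ hρ => ?_) measurableSet_Ioc
    have h := norm_kerG_le hρ.1 y
    rw [envelope, if_neg (by linarith [hρ.2])] at h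
    simp only
    rw [norm_le_zero_iff.1 h, zero_mul]
  · refine (integrableOn_Ioi_rpow_of_lt (show (-3 : ℝ) < -1 by norm_num) hR).mono'
      hm.aestronglyMeasurable ?_
    refine (ae_restrict_mem measurableSet_Ioi).mono fun ρ hρ => ?_
    have hρ' : 0 < ρ := hR.trans hρ
    have h : ‖kerG ρ y‖ ≤ 1 / ρ ^ 2 := (norm_kerG_le hρ' y).trans (by
      unfold envelope; split_ifs; exacts [le_rfl, by positivity])
    rw [norm_mul, Complex.norm_real, Real.norm_of_nonneg (by positivity),
      show (-3 : ℝ) = ((-3 : ℤ) : ℝ) by norm_num, Real.rpow_intCast]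
    refine (mul_le_mul_of_nonneg_right h (by positivity)).trans_eq ?_
    rw [zpow_neg, show (3 : ℤ) = ((3 : ℕ) : ℤ) by rfl, zpow_natCast]
    field_simp

lemma iUnion_Ioc_two_zpow : ⋃ n : ℤ, Ioc ((2 : ℝ) ^ n) ((2 : ℝ) ^ (n + 1)) = Ioi 0 := by
  ext x
  simp only [mem_iUnion]
  constructor
  · rintro ⟨n, hn⟩
    exact (show (0 : ℝ) < 2 ^ n by positivity).trans hn.1
  · exact fun hx => exists_mem_Ioc_zpow hx one_lt_two

/-- The intervals $(2^n,2^{n+1}]$ tile $(0,\infty)$, and $d\rho/\rho$ is invariant under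
$\rho=2^nr$. -/
lemma hasSum_integral_kerG {y : ℂ} (hy : y ≠ 0) :
    HasSum (fun n : ℤ => ∫ r in (1 : ℝ)..2, kerG ((2 : ℝ) ^ n * r) y * ((1 / r : ℝ) : ℂ))
      (((1 / (2 * Real.pi) : ℝ) : ℂ) * phaseMean * (1 / y ^ 2)) := by
  have hmono : Monotone (fun n : ℤ => (2 : ℝ) ^ n) := fun m n h =>
    zpow_le_zpow_right₀ one_le_two h
  have h := hasSum_integral_iUnion (μ := volume)
    (s := fun n : ℤ => Ioc ((2 : ℝ) ^ n) ((2 : ℝ) ^ (n + 1))) (fun n => measurableSet_Ioc)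
    (hmono.pairwise_disjoint_on_Ioc_succ)
    (by rw [iUnion_Ioc_two_zpow]; exact integrableOn_kerG_div hy)
  rw [iUnion_Ioc_two_zpow, integral_kerG_div hy] at h
  refine h.congr_fun fun n => ?_
  have h2 : (0 : ℝ) < 2 ^ n := by positivity
  have e := intervalIntegral.integral_comp_mul_left
    (fun ρ : ℝ => kerG ρ y * ((1 / ρ : ℝ) : ℂ)) h2.ne' (a := 1) (b := 2)
  rw [mul_one, ← zpow_add_one₀ two_ne_zero, eq_inv_smul_iff₀ h2.ne'] at e
  rw [← intervalIntegral.integral_of_le (zpow_le_zpow_right₀ one_le_two (by lia)), ← e,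
    ← intervalIntegral.integral_smul]
  refine intervalIntegral.integral_congr fun r _ => ?_
  simp only [Complex.real_smul]
  have h3 : ((2 : ℂ) ^ n) ≠ 0 := zpow_ne_zero _ two_ne_zero
  push_cast
  field_simp

lemma summable_norm_kerG_mul_div {r : ℝ} (hr : r ∈ Ioc (1 : ℝ) 2) (y : ℂ) :
    Summable (fun n : ℤ => ‖kerG ((2 : ℝ) ^ n * r) y * ((1 / r : ℝ) : ℂ)‖) ∧
      ∑' n : ℤ, ‖kerG ((2 : ℝ) ^ n * r) y * ((1 / r : ℝ) : ℂ)‖ ≤ 6 * (1 / ‖y‖ ^ 2) := by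
  have hr0 : 0 < r := one_pos.trans hr.1
  obtain ⟨h1, h2⟩ := summable_norm_kerG_mul hr0 y ((1 / r : ℝ) : ℂ)
  refine ⟨h1, h2.trans ?_⟩
  rw [Complex.norm_real, Real.norm_of_nonneg (by positivity)]
  gcongr
  exact div_le_one_of_le₀ hr.1.le hr0.le

/-- Averaged over the calibres, the lattice kernels become a multiple of `1 / y²`. -/
lemma integral_kerLattice_div {y : ℂ} (hy : y ≠ 0) :
    ∫ r in Ioc (1 : ℝ) 2, kerLattice r y * ((1 / r : ℝ) : ℂ) =
      ((1 / (2 * Real.pi) : ℝ) : ℂ) * phaseMean * (1 / y ^ 2) := by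
  have hm : ∀ n : ℤ, Measurable (fun r : ℝ => kerG ((2 : ℝ) ^ n * r) y * ((1 / r : ℝ) : ℂ)) :=
    fun n => (measurable_kerG_comp (measurable_id.const_mul _) measurable_const).mul
      (by fun_prop : Measurable (fun ρ : ℝ => ((1 / ρ : ℝ) : ℂ)))
  have hr : ∀ᵐ r : ℝ ∂volume.restrict (Ioc 1 2), r ∈ Ioc (1 : ℝ) 2 :=
    ae_restrict_mem measurableSet_Ioc
  have h := hasSum_integral_of_dominated_convergence (μ := volume.restrict (Ioc (1 : ℝ) 2))
    (F := fun (n : ℤ) r => kerG ((2 : ℝ) ^ n * r) y * ((1 / r : ℝ) : ℂ))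
    (f := fun r => kerLattice r y * ((1 / r : ℝ) : ℂ))
    (fun n r => ‖kerG ((2 : ℝ) ^ n * r) y * ((1 / r : ℝ) : ℂ)‖)
    (fun n => (hm n).aestronglyMeasurable) (fun n => Eventually.of_forall fun y => le_rfl)
    (hr.mono fun r hr => (summable_norm_kerG_mul_div hr y).1) ?_
    (hr.mono fun r hr => (summable_kerG (one_pos.trans hr.1) y).hasSum.mul_right _)
  · have h2 := hasSum_integral_kerG hy
    simp only [intervalIntegral.integral_of_le (one_le_two (α := ℝ))] at h2
    exact h.unique h2
  · refine (integrable_const (6 * (1 / ‖y‖ ^ 2))).mono'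
      (Measurable.tsum fun n => (hm n).norm).aestronglyMeasurable (hr.mono fun r hr => ?_)
    rw [Real.norm_of_nonneg (tsum_nonneg fun n => norm_nonneg _)]
    exact (summable_norm_kerG_mul_div hr y).2

lemma integrable_prod_kerLattice (f : 𝓢(ℂ, ℂ)) (z : ℂ) :
    Integrable (fun p : ℝ × ℂ =>
        kerLattice p.1 p.2 * ((1 / p.1 : ℝ) : ℂ) * turnDiff f z p.2)
      ((volume.restrict (Ioc (1 : ℝ) 2)).prod volume) := by
  have h1 : Integrable (fun p : ℝ × ℂ => (6 : ℝ) * (‖turnDiff f z p.2‖ / ‖p.2‖ ^ 2))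
      ((volume.restrict (Ioc (1 : ℝ) 2)).prod volume) :=
    Integrable.mul_prod (f := fun _ : ℝ => (6 : ℝ)) (integrable_const _)
      (integrable_turnDiff_div f z)
  have hm : Measurable (fun p : ℝ × ℂ =>
      kerLattice p.1 p.2 * ((1 / p.1 : ℝ) : ℂ) * turnDiff f z p.2) :=
    (measurable_kerLattice.mul
      (by fun_prop : Measurable (fun p : ℝ × ℂ => ((1 / p.1 : ℝ) : ℂ)))).mul
      ((continuous_turnDiff f.continuous z).measurable.comp measurable_snd)
  refine h1.mono' hm.aestronglyMeasurable ?_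
  have hmem : ∀ᵐ p : ℝ × ℂ ∂(volume.restrict (Ioc (1 : ℝ) 2)).prod volume, p.1 ∈ Ioc (1 : ℝ) 2 :=
    Measure.quasiMeasurePreserving_fst.ae (ae_restrict_mem measurableSet_Ioc)
  refine hmem.mono fun p hp => ?_
  have hp0 : 0 < p.1 := one_pos.trans hp.1
  have h2 := (isTurnKernel_kerLattice hp0).norm_mul_turnDiff_le f z p.2
  rw [mul_right_comm, norm_mul, Complex.norm_real, Real.norm_of_nonneg (by positivity)]
  refine (mul_le_of_le_one_right (norm_nonneg _) ?_).trans h2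
  exact div_le_one_of_le₀ hp.1.le hp0.le

lemma latticeAverage_mul_eqOn (f : 𝓢(ℂ, ℂ)) (z : ℂ) :
    EqOn (fun r : ℝ => 1 / 2 * ∫ y, kerLattice r y * ((1 / r : ℝ) : ℂ) * turnDiff f z y)
      (fun r : ℝ => latticeAverage r f z * ((1 / r : ℝ) : ℂ)) (Ioc 1 2) := fun r hr => by
  simp only [latticeAverage_eq (one_pos.trans hr.1)]
  rw [mul_assoc, ← integral_mul_const]
  simp only [mul_right_comm]

lemma intervalIntegrable_latticeAverage (f : 𝓢(ℂ, ℂ)) (z : ℂ) :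
    IntervalIntegrable (fun r : ℝ => latticeAverage r f z * ((1 / r : ℝ) : ℂ)) volume 1 2 := by
  rw [intervalIntegrable_iff_integrableOn_Ioc_of_le one_le_two]
  exact IntegrableOn.congr_fun ((integrable_prod_kerLattice f z).integral_prod_left.const_mul _)
    (latticeAverage_mul_eqOn f z) measurableSet_Ioc

/-- Fubini moves the calibre integral inside, where it acts on the kernel alone; the excluded point
$y=0$ is null. -/
lemma fullAverage_eq (f : 𝓢(ℂ, ℂ)) (z : ℂ) : fullAverage f z =
    ((1 / (2 * Real.pi) : ℝ) : ℂ) * phaseMean * (1 / 2 * ∫ y, 1 / y ^ 2 * turnDiff f z y) := by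
  rw [fullAverage, intervalIntegral.integral_of_le one_le_two,
    ← setIntegral_congr_fun measurableSet_Ioc (latticeAverage_mul_eqOn f z), integral_const_mul,
    integral_integral_swap
      (f := fun (r : ℝ) (y : ℂ) => kerLattice r y * ((1 / r : ℝ) : ℂ) * turnDiff f z y)
      (integrable_prod_kerLattice f z), mul_left_comm]
  congr 1
  rw [← integral_const_mul]
  refine integral_congr_ae ?_
  filter_upwards [Measure.ae_ne volume (0 : ℂ)] with y hy
  rw [integral_mul_const, integral_kerLattice_div hy, mul_assoc _ _ (turnDiff f z y)]

/-! ### The constant as a real integral, and its closed form -/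

lemma integrable_kerF : Integrable kerF := by
  have h : IntegrableOn kerF (Metric.closedBall 0 2) :=
    continuous_kerF.continuousOn.integrableOn_compact (isCompact_closedBall 0 2)
  refine h.integrable_of_forall_notMem_eq_zero fun z hz => kerF_of_two_le ?_
  rw [mem_closedBall_zero_iff, not_le] at hz
  exact hz.le

/-- The value of the constant as an integral of `F` against `cos 2φ`. -/
lemma phaseMean_eq : phaseMean =
    ((∫ z : ℂ, kerF z * ((z.re ^ 2 - z.im ^ 2) / (z.re ^ 2 + z.im ^ 2)) : ℝ) : ℂ) := by
  have hsq : ∀ w : ℂ, (w / (‖w‖ : ℂ)) ^ 2 = (((w.re ^ 2 - w.im ^ 2) / (w.re ^ 2 + w.im ^ 2) : ℝ) : ℂ)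
      + ((2 * w.re * w.im / (w.re ^ 2 + w.im ^ 2) : ℝ) : ℂ) * Complex.I := fun w => by
    have h : (‖w‖ : ℂ) ^ 2 = ((w.re ^ 2 + w.im ^ 2 : ℝ) : ℂ) := by
      rw [← Complex.ofReal_pow, Complex.sq_norm, Complex.normSq_apply]
      ring_nf
    rw [div_pow, h, Complex.ofReal_div, Complex.ofReal_div, div_mul_eq_mul_div, ← add_div]
    congr 1
    conv_lhs => rw [← Complex.re_add_im w]
    push_cast
    linear_combination (w.im : ℂ) ^ 2 * Complex.I_sq
  -- Since $\alpha$ is even, $F$ is invariant under conjugation, so the mean is real and only the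
  -- $\cos2\varphi$ part survives.
  have hconj : (starRingEnd ℂ) phaseMean = phaseMean := by
    have h1 : (starRingEnd ℂ) phaseMean =
        ∫ w : ℂ, (starRingEnd ℂ) ((kerF w : ℂ) * (w / ‖w‖) ^ 2) := integral_conj.symm
    have h2 := (Complex.conjLIE.measurePreserving).integral_comp
      Complex.conjLIE.toHomeomorph.measurableEmbedding (fun w : ℂ => (kerF w : ℂ) * (w / ‖w‖) ^ 2)
    rw [h1, phaseMean, ← h2]
    refine integral_congr_ae (Eventually.of_forall fun w => ?_)
    simp only [Complex.conjLIE_apply, map_mul, map_pow, map_div₀, Complex.conj_ofReal,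
      Complex.norm_conj, kerF, Complex.conj_re, Complex.conj_im, alpha_neg]
  have hint : Integrable (fun w : ℂ => (kerF w : ℂ) * (w / ‖w‖) ^ 2) := by
    refine integrable_kerF.ofReal.mul_bdd (c := 1)
      (by fun_prop : Measurable (fun w : ℂ => (w / (‖w‖ : ℂ)) ^ 2)).aestronglyMeasurable
      (Eventually.of_forall fun w => ?_)
    rw [norm_pow, norm_div, Complex.norm_real, norm_norm]
    exact pow_le_one₀ (by positivity) (div_self_le_one _)
  have hre := integral_re hint
  rw [← Complex.conj_eq_iff_re.1 hconj, phaseMean]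
  refine congrArg _ (hre.symm.trans (integral_congr_ae (Eventually.of_forall fun w => ?_)))
  simp only [hsq, RCLike.re_to_complex, Complex.re_ofReal_mul, Complex.add_re, Complex.ofReal_re,
    Complex.I_re, mul_zero, add_zero]

lemma integral_eq_two_mul_of_even {h : ℝ → ℝ} (he : ∀ x, h (-x) = h x)
    (h1 : ∀ x, 1 ≤ x → h x = 0) : ∫ x, h x = 2 * ∫ x in (0 : ℝ)..1, h x := by
  have habs : ∀ x, h |x| = h x := fun x => by
    rcases abs_choice x with hx | hx <;> rw [hx]
    exact he x
  have h2 := integral_comp_abs (f := h)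
  simp only [habs] at h2
  rw [h2, intervalIntegral.integral_of_le zero_le_one]
  congr 1
  refine setIntegral_eq_of_subset_of_forall_sdiff_eq_zero measurableSet_Ioi
    Ioc_subset_Ioi_self fun x hx => h1 x ?_
  by_contra! hlt
  exact hx.2 ⟨hx.1, hlt.le⟩

lemma integral_linear_mul_ratio {y : ℝ} (hy : 0 < y) :
    ∫ x in (0 : ℝ)..1, (1 - x) * ((x ^ 2 - y ^ 2) / (x ^ 2 + y ^ 2)) =
      1 / 2 - 2 * y * Real.arctan (1 / y) + y ^ 2 * (Real.log (1 + y ^ 2) - 2 * Real.log y) := by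
  have hpos : ∀ x : ℝ, 0 < x ^ 2 + y ^ 2 := fun x => by positivity
  have hderiv : ∀ x ∈ uIcc (0 : ℝ) 1, HasDerivAt
      (fun x => x - x ^ 2 / 2 - 2 * y * Real.arctan (x / y) + y ^ 2 * Real.log (x ^ 2 + y ^ 2))
      ((1 - x) * ((x ^ 2 - y ^ 2) / (x ^ 2 + y ^ 2))) x := fun x _ => by
    have hsq : HasDerivAt (fun x : ℝ => x ^ 2) (2 * x) x := by simpa using hasDerivAt_pow 2 x
    have hA := ((hasDerivAt_id x).div_const y).arctan.const_mul (2 * y)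
    have hL := ((hsq.add_const (y ^ 2)).log (hpos x).ne').const_mul (y ^ 2)
    refine ((((hasDerivAt_id x).sub (hsq.div_const 2)).sub hA).add hL).congr_deriv ?_
    have := (hpos x).ne'
    have h3 : y ^ 2 + x ^ 2 ≠ 0 := by rwa [add_comm]
    simp only [id_eq]
    field_simp
    ring
  rw [intervalIntegral.integral_eq_sub_of_hasDerivAt hderiv]
  · have : Real.log (y ^ 2) = 2 * Real.log y := by rw [Real.log_pow]; norm_num
    simp only [zero_div, Real.arctan_zero]
    norm_num [this]
    ring
  · refine Continuous.intervalIntegrable ?_ _ _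
    exact (by fun_prop : Continuous fun x : ℝ => 1 - x).mul
      (Continuous.div (by fun_prop) (by fun_prop) fun x => (hpos x).ne')

/-- The function `y ↦ ∫₀¹ (1 - x) 2y² / (x² + y²) dx` on `y > 0`, in closed form. -/
def innerTerm (y : ℝ) : ℝ :=
  2 * y * (Real.pi / 2 - Real.arctan y) - y ^ 2 * Real.log (1 + y ^ 2) + 2 * y * (y * Real.log y)

/-- A primitive of `innerTerm`. -/
def innerPrimitive (y : ℝ) : ℝ :=
  Real.pi * y ^ 2 / 2 - (1 / 3 + y ^ 2) * Real.arctan y + y / 3 - y ^ 3 / 3 * Real.log (1 + y ^ 2)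
    + 2 / 3 * y ^ 2 * (y * Real.log y)

/-- A primitive of `y * innerTerm y`. -/
def innerMomentPrimitive (y : ℝ) : ℝ :=
  Real.pi * y ^ 3 / 3 - 2 / 3 * y ^ 3 * Real.arctan y + y ^ 2 / 12 -
    (1 / 12 + y ^ 4 / 4) * Real.log (1 + y ^ 2) + 1 / 2 * y ^ 3 * (y * Real.log y)

lemma continuous_log_one_add_sq : Continuous (fun y : ℝ => Real.log (1 + y ^ 2)) :=
  Continuous.log (by fun_prop) fun y => by positivity

/-- The logarithm enters only through the block $y\log y$, which is continuous at $0$; the same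
grouping serves both primitives. -/
lemma continuous_innerTerm : Continuous innerTerm := by
  unfold innerTerm
  have h1 := continuous_log_one_add_sq
  have h2 := Real.continuous_mul_log
  have h3 := Real.continuous_arctan
  fun_prop

lemma continuous_innerPrimitive : Continuous innerPrimitive := by
  unfold innerPrimitive
  have h1 := continuous_log_one_add_sq
  have h2 := Real.continuous_mul_log
  have h3 := Real.continuous_arctan
  fun_prop

lemma continuous_innerMomentPrimitive : Continuous innerMomentPrimitive := by
  unfold innerMomentPrimitive
  have h1 := continuous_log_one_add_sq
  have h2 := Real.continuous_mul_log
  have h3 := Real.continuous_arctan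
  fun_prop

lemma hasDerivAt_pow_succ (n : ℕ) (y : ℝ) :
    HasDerivAt (fun y : ℝ => y ^ (n + 1)) ((n + 1) * y ^ n) y := by
  simpa using hasDerivAt_pow (n + 1) y

lemma hasDerivAt_log_one_add_sq (y : ℝ) :
    HasDerivAt (fun y : ℝ => Real.log (1 + y ^ 2)) (2 * y / (1 + y ^ 2)) y := by
  have h := ((hasDerivAt_pow_succ 1 y).const_add 1).log
    (by norm_num; positivity : (1 : ℝ) + y ^ (1 + 1) ≠ 0)
  refine h.congr_deriv ?_
  norm_num

lemma hasDerivAt_innerPrimitive {y : ℝ} (hy : 0 < y) :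
    HasDerivAt innerPrimitive (innerTerm y) y := by
  have h2 := hasDerivAt_pow_succ 1 y
  have h3 := hasDerivAt_pow_succ 2 y
  have hA := Real.hasDerivAt_arctan y
  have hL := hasDerivAt_log_one_add_sq y
  have hl := Real.hasDerivAt_mul_log hy.ne'
  have hp : 1 + y ^ 2 ≠ 0 := by positivity
  refine ((((((h2.const_mul Real.pi).div_const 2).sub ((h2.const_add (1 / 3)).mul hA)).add
    ((hasDerivAt_id y).div_const 3)).sub ((h3.div_const 3).mul hL)).add
    ((h2.const_mul (2 / 3)).mul hl)).congr_deriv ?_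
  rw [innerTerm]
  norm_num
  field_simp
  ring

lemma hasDerivAt_innerMomentPrimitive {y : ℝ} (hy : 0 < y) :
    HasDerivAt innerMomentPrimitive (y * innerTerm y) y := by
  have h2 := hasDerivAt_pow_succ 1 y
  have h3 := hasDerivAt_pow_succ 2 y
  have h4 := hasDerivAt_pow_succ 3 y
  have hA := Real.hasDerivAt_arctan y
  have hL := hasDerivAt_log_one_add_sq y
  have hl := Real.hasDerivAt_mul_log hy.ne'
  have hp : 1 + y ^ 2 ≠ 0 := by positivity
  refine ((((((h3.const_mul Real.pi).div_const 3).sub ((h3.const_mul (2 / 3)).mul hA)).add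
    (h2.div_const 12)).sub (((h4.div_const 4).const_add (1 / 12)).mul hL)).add
    ((h3.const_mul (1 / 2)).mul hl)).congr_deriv ?_
  rw [innerTerm]
  norm_num
  field_simp
  ring

lemma alpha_of_le_half {y : ℝ} (h0 : 0 ≤ y) (h1 : y ≤ 1 / 2) : alpha y = 3 * y - 1 := by
  rw [alpha_eq, tri, tri, tri, abs_of_nonpos (by linarith), abs_of_nonneg (by linarith),
    abs_of_nonneg (by linarith), max_eq_right (by linarith), max_eq_left (by linarith),
    max_eq_right (by linarith)]
  ring

lemma alpha_of_half_le {y : ℝ} (h0 : 1 / 2 ≤ y) (h1 : y ≤ 1) : alpha y = 1 - y := by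
  rw [alpha_eq, tri, tri, tri, abs_of_nonneg (by linarith), abs_of_nonneg (by linarith),
    abs_of_nonneg (by linarith), max_eq_right (by linarith), max_eq_left (by linarith),
    max_eq_left (by linarith)]
  ring

/-- The form needed because $\alpha$ is affine on $[0,1/2]$ and on $[1/2,1]$. Derivatives are
required only in the open interval, with continuity at the ends, so $u=0$ is allowed. -/
lemma integral_linear_mul_innerTerm (a b : ℝ) {u v : ℝ} (hu : 0 ≤ u) (huv : u ≤ v) :
    ∫ y in u..v, (a + b * y) * (1 / 2 - innerTerm y) =
      ((a * v + b * v ^ 2 / 2) / 2 - a * innerPrimitive v - b * innerMomentPrimitive v) -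
      ((a * u + b * u ^ 2 / 2) / 2 - a * innerPrimitive u - b * innerMomentPrimitive u) := by
  have c1 := continuous_innerTerm
  have c2 := continuous_innerPrimitive
  have c3 := continuous_innerMomentPrimitive
  refine intervalIntegral.integral_eq_sub_of_hasDerivAt_of_le
    (f := fun v => (a * v + b * v ^ 2 / 2) / 2 - a * innerPrimitive v - b * innerMomentPrimitive v)
    huv (by fun_prop) (fun y hy => ?_) (Continuous.intervalIntegrable (by fun_prop) _ _)
  have hy0 : 0 < y := hu.trans_lt hy.1
  refine ((((((hasDerivAt_id y).const_mul a).add (((hasDerivAt_pow_succ 1 y).const_mul b).div_const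
    2)).div_const 2).sub ((hasDerivAt_innerPrimitive hy0).const_mul a)).sub
    ((hasDerivAt_innerMomentPrimitive hy0).const_mul b)).congr_deriv ?_
  norm_num
  ring

lemma integral_alpha_mul_innerTerm :
    ∫ y in (0 : ℝ)..1, alpha y * (1 / 2 - innerTerm y) =
      2 * (1 / 12 * (Real.arctan 2 - 4 * Real.arctan (1 / 2) + 15 / 8 * Real.log 5
        - 4 * Real.log 2)) := by
  have c1 := continuous_innerTerm
  have c2 := continuous_alpha
  have hc : Continuous (fun y => alpha y * (1 / 2 - innerTerm y)) := by fun_prop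
  have e1 : ∫ y in (0 : ℝ)..(1 / 2), alpha y * (1 / 2 - innerTerm y) =
      ∫ y in (0 : ℝ)..(1 / 2), (-1 + 3 * y) * (1 / 2 - innerTerm y) := by
    refine intervalIntegral.integral_congr fun y hy => ?_
    rw [uIcc_of_le (by norm_num)] at hy
    simp only [alpha_of_le_half hy.1 hy.2]
    ring
  have e2 : ∫ y in (1 / 2 : ℝ)..1, alpha y * (1 / 2 - innerTerm y) =
      ∫ y in (1 / 2 : ℝ)..1, (1 + -1 * y) * (1 / 2 - innerTerm y) := by
    refine intervalIntegral.integral_congr fun y hy => ?_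
    rw [uIcc_of_le (by norm_num)] at hy
    simp only [alpha_of_half_le hy.1 hy.2]
    ring
  have l1 : Real.log (1 + (1 / 2) ^ 2) = Real.log 5 - 2 * Real.log 2 := by
    rw [show (1 + (1 / 2) ^ 2 : ℝ) = 5 / 2 ^ 2 by norm_num, Real.log_div (by norm_num)
      (by norm_num), Real.log_pow]
    norm_num
  have l2 : Real.log (1 / 2) = -Real.log 2 := by rw [one_div, Real.log_inv]
  have l3 : Real.arctan 2 = Real.pi / 2 - Real.arctan (1 / 2) := by
    have := Real.arctan_inv_of_pos (zero_lt_two (α := ℝ))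
    rw [one_div, this]; ring
  have l4 : Real.log (1 + 1 ^ 2) = Real.log 2 := by norm_num
  rw [← intervalIntegral.integral_add_adjacent_intervals (hc.intervalIntegrable 0 (1 / 2))
    (hc.intervalIntegrable (1 / 2) 1), e1, e2,
    integral_linear_mul_innerTerm _ _ le_rfl (by norm_num),
    integral_linear_mul_innerTerm _ _ (by norm_num) (by norm_num)]
  simp only [innerPrimitive, innerMomentPrimitive, l1, l2, l3, l4, Real.arctan_one,
    Real.arctan_zero, Real.log_one]
  norm_num
  ring

/-- Evenness in $x$ reduces to $[0,1]$, where $\beta(x)=1-x$; writing the ratio as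
$1-2y^2/(x^2+y^2)$ explains $\frac12-$ `innerTerm`. -/
lemma integral_alpha_mul_ratio {y : ℝ} (hy : 0 < y) :
    ∫ x, -(beta x * alpha y) * ((x ^ 2 - y ^ 2) / (x ^ 2 + y ^ 2)) =
      -2 * (alpha y * (1 / 2 - innerTerm y)) := by
  rw [integral_eq_two_mul_of_even]
  · have e : ∫ x in (0 : ℝ)..1, -(beta x * alpha y) * ((x ^ 2 - y ^ 2) / (x ^ 2 + y ^ 2)) =
        ∫ x in (0 : ℝ)..1, -alpha y * ((1 - x) * ((x ^ 2 - y ^ 2) / (x ^ 2 + y ^ 2))) := by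
      refine intervalIntegral.integral_congr fun x hx => ?_
      rw [uIcc_of_le zero_le_one] at hx
      simp only [beta_eq, tri, abs_of_nonneg hx.1, max_eq_right (sub_nonneg.2 hx.2)]
      ring
    have harctan := Real.arctan_inv_of_pos hy
    rw [e, intervalIntegral.integral_const_mul, integral_linear_mul_ratio hy, one_div y, harctan,
      innerTerm]
    ring
  · intro x
    rw [beta_neg, neg_sq]
  · intro x hx
    rw [beta_of_one_le (hx.trans (le_abs_self x))]
    simp

lemma integral_kerF_mul_ratio :
    -(1 / 2) * (∫ z : ℂ, kerF z * ((z.re ^ 2 - z.im ^ 2) / (z.re ^ 2 + z.im ^ 2))) =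
      4 * (1 / 12 * (Real.arctan 2 - 4 * Real.arctan (1 / 2) + 15 / 8 * Real.log 5
        - 4 * Real.log 2)) := by
  set g : ℝ × ℝ → ℝ := fun p =>
    -(beta p.1 * alpha p.2) * ((p.1 ^ 2 - p.2 ^ 2) / (p.1 ^ 2 + p.2 ^ 2)) with hg
  have hcomp : (fun z : ℂ => kerF z * ((z.re ^ 2 - z.im ^ 2) / (z.re ^ 2 + z.im ^ 2))) =
      g ∘ Complex.measurableEquivRealProd := rfl
  have hint : Integrable g := by
    rw [← Complex.volume_preserving_equiv_real_prod.integrable_comp_emb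
      Complex.measurableEquivRealProd.measurableEmbedding, ← hcomp]
    refine integrable_kerF.mul_bdd (c := 1) (by fun_prop : Measurable fun z : ℂ =>
      (z.re ^ 2 - z.im ^ 2) / (z.re ^ 2 + z.im ^ 2)).aestronglyMeasurable
      (Eventually.of_forall fun z => ?_)
    rw [Real.norm_eq_abs, abs_div, abs_of_nonneg (by positivity : 0 ≤ z.re ^ 2 + z.im ^ 2)]
    refine div_le_one_of_le₀ (abs_le.2 ⟨?_, ?_⟩) (by positivity) <;>
      nlinarith [sq_nonneg z.re, sq_nonneg z.im]
  have h1 : ∫ z : ℂ, kerF z * ((z.re ^ 2 - z.im ^ 2) / (z.re ^ 2 + z.im ^ 2)) =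
      ∫ y, ∫ x, g (x, y) :=
    (Complex.volume_preserving_equiv_real_prod.integral_comp
      Complex.measurableEquivRealProd.measurableEmbedding g).trans (integral_prod_symm g hint)
  -- With $x$ innermost, evenness leaves only $y\in(0,1]$, so the inner formula, valid for $y>0$,
  -- applies throughout.
  have h2 : ∫ y in (0 : ℝ)..1, ∫ x, g (x, y) =
      ∫ y in (0 : ℝ)..1, -2 * (alpha y * (1 / 2 - innerTerm y)) := by
    rw [intervalIntegral.integral_of_le zero_le_one, intervalIntegral.integral_of_le zero_le_one]
    exact setIntegral_congr_fun measurableSet_Ioc fun y hy => integral_alpha_mul_ratio hy.1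
  rw [h1, integral_eq_two_mul_of_even, h2, intervalIntegral.integral_const_mul,
    integral_alpha_mul_innerTerm]
  · ring
  · intro y
    simp only [hg, alpha_neg, neg_sq]
  · intro y hy
    simp only [hg, alpha_of_one_le (hy.trans (le_abs_self y))]
    simp

/-! ### Numerical value of the constant -/

/-- The alternating Taylor polynomials of degrees 5 and 7 bracket $\arctan$ on $x\ge0$: their
differences from it have derivatives $x^6/(1+x^2)$ and $x^8/(1+x^2)$. -/
lemma arctan_half_bounds :
    (0.4634 : ℝ) < Real.arctan (1 / 2) ∧ Real.arctan (1 / 2) < 0.4646 := by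
  have hA := Real.hasDerivAt_arctan
  have hp : ∀ x : ℝ, HasDerivAt (fun x : ℝ => x - x ^ 3 / 3 + x ^ 5 / 5) (1 - x ^ 2 + x ^ 4) x :=
    fun x => (((hasDerivAt_id x).sub ((hasDerivAt_pow_succ 2 x).div_const 3)).add
      ((hasDerivAt_pow_succ 4 x).div_const 5)).congr_deriv (by norm_num)
  have hup : ∀ x : ℝ, HasDerivAt (fun x => x - x ^ 3 / 3 + x ^ 5 / 5 - Real.arctan x)
      (x ^ 6 / (1 + x ^ 2)) x := fun x => ((hp x).sub (hA x)).congr_deriv (by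
    field_simp; ring)
  have hlo : ∀ x : ℝ, HasDerivAt
      (fun x => Real.arctan x - (x - x ^ 3 / 3 + x ^ 5 / 5 - x ^ 7 / 7))
      (x ^ 8 / (1 + x ^ 2)) x := fun x =>
    ((hA x).sub ((hp x).sub ((hasDerivAt_pow_succ 6 x).div_const 7))).congr_deriv (by
      norm_num; field_simp; ring)
  have m1 := monotone_of_hasDerivAt_nonneg hup (fun x => by positivity)
    (by norm_num : (0 : ℝ) ≤ 1 / 2)
  have m2 := monotone_of_hasDerivAt_nonneg hlo (fun x => by positivity)
    (by norm_num : (0 : ℝ) ≤ 1 / 2)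
  simp only [Real.arctan_zero] at m1 m2
  norm_num at m1 m2
  constructor <;> norm_num <;> linarith

lemma abs_constant_lt : |1 / 12 * (Real.arctan 2 - 4 * Real.arctan (1 / 2) + 15 / 8 * Real.log 5
    - 4 * Real.log 2) - (-0.042)| < 0.0005 := by
  have l3 : Real.arctan 2 = Real.pi / 2 - Real.arctan (1 / 2) := by
    have := Real.arctan_inv_of_pos (zero_lt_two (α := ℝ))
    rw [one_div, this]; ring
  obtain ⟨a1, a2⟩ := arctan_half_bounds
  have p1 := Real.pi_gt_d4
  have p2 := Real.pi_lt_d4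
  have b1 := Real.log_two_gt_d9
  have b2 := Real.log_two_lt_d9
  have d1 := Real.log_five_gt_d9
  have d2 := Real.log_five_lt_d9
  rw [l3, abs_lt]
  constructor <;> linarith

end HaarAveraging

end

open HaarAveraging in
theorem proposition3p3 :
    -- all the averages and principal values involved exist
    (∀ (f : 𝓢(ℂ, ℂ)) (z : ℂ) (ρ : ℝ), 0 < ρ →
      (∀ ψ : ℝ, IntegrableOn
        (fun t => gridProjection ρ t (rot (-ψ) f) (Complex.exp (-(ψ : ℂ) * Complex.I) * z))
        (refPoints ρ)) ∧
      IntervalIntegrable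
        (fun ψ : ℝ => rot ψ (translationAverage ρ (rot (-ψ) f)) z * rotWeight ψ)
        volume 0 (2 * Real.pi)) ∧
    (∀ r : ℝ, 0 < r → ∀ z : ℂ, Summable (fun n : ℤ => kerG ((2 : ℝ) ^ n * r) z)) ∧
    (∀ (f : 𝓢(ℂ, ℂ)) (z : ℂ) (r : ℝ), 0 < r → PVExists (fun y => kerLattice r y * f (z - y)) 0) ∧
    (∀ (f : 𝓢(ℂ, ℂ)) (z : ℂ), IntervalIntegrable
      (fun r : ℝ => latticeAverage r f z * ((1 / r : ℝ) : ℂ)) volume 1 2) ∧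
    (∀ (f : 𝓢(ℂ, ℂ)) (z : ℂ), PVExists (fun ζ => f ζ / (ζ - z) ^ 2) z) ∧
    -- the operator for the calibre `r` is the sum of the averages of the Haar projections over
    -- the translated and rotated grids of sizes `2 ^ n * r`
    (∀ (f : 𝓢(ℂ, ℂ)) (z : ℂ) (r : ℝ), 0 < r →
      HasSum (fun n : ℤ => rotationAverage ((2 : ℝ) ^ n * r) f z) (latticeAverage r f z)) ∧
    -- the final average is `c T`, with an explicit nonzero constant `c`
    ∃ c : ℝ, c ≠ 0 ∧
      c = -(1 / 2) * (∫ z : ℂ, kerF z * ((z.re ^ 2 - z.im ^ 2) / (z.re ^ 2 + z.im ^ 2))) ∧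
      c = 4 * (1 / 12 * (Real.arctan 2 - 4 * Real.arctan (1 / 2) + 15 / 8 * Real.log 5
        - 4 * Real.log 2)) ∧
      |c / 4 - (-0.042)| < 0.0005 ∧
      ∀ (f : 𝓢(ℂ, ℂ)) (z : ℂ), fullAverage f z = (c : ℂ) * ahlforsBeurling f z := by
  refine ⟨fun f z ρ hρ => ⟨fun ψ => ?_, intervalIntegrable_rot_translationAverage hρ f.integrable z⟩,
    fun r hr z => summable_kerG hr z, fun f z r hr => (isTurnKernel_kerLattice hr).pvExists f z,
    intervalIntegrable_latticeAverage, pvExists_beurling,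
    fun f z r hr => hasSum_rotationAverage f z hr,
    4 * (1 / 12 * (Real.arctan 2 - 4 * Real.arctan (1 / 2) + 15 / 8 * Real.log 5
        - 4 * Real.log 2)), ?_, integral_kerF_mul_ratio.symm, rfl, ?_, fun f z => ?_⟩
  · exact integrableOn_gridProjection hρ (continuous_rot f.continuous _).measurable
      (integrable_rot f.integrable _) _
  -- Zero is not within $0.0005$ of $-0.042$.
  · intro h
    have h1 := abs_lt.1 abs_constant_lt
    rw [mul_eq_zero_iff_left four_ne_zero] at h
    rw [h] at h1
    norm_num at h1
  · rw [mul_div_cancel_left₀ _ four_ne_zero]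
    exact abs_constant_lt
  -- The factor $\frac1{2\pi}$ of the averaged kernel against $-\frac1\pi$ in $T$ leaves
  -- $c=-\frac12$ `phaseMean`.
  · rw [fullAverage_eq, phaseMean_eq, ahlforsBeurling_eq, ← integral_kerF_mul_ratio]
    have hpi : (Real.pi : ℂ) ≠ 0 := Complex.ofReal_ne_zero.2 Real.pi_ne_zero
    push_cast
    field_simp
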